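/- Let $n\ge 1$ be an integer and let $p>1$ be real. For a random vector $X$ in $\mathbb{R}^n$ with density $f$ with respect to Lebesgue measure, let $$h_p(X)=\frac{1}{1-p}\log\int_{\mathbb{R}^n} f(x)^p\,dx\in[-\infty,\infty],\qquad N_p(X)=e^{2h_p(X)/n},$$ where $\log$ is the natural logarithm, $h_p(X)$ is the $p$-Rényi entropy of $X$ and $N_p(X)$ is its $p$-Rényi entropy power. We say that a random vector has finite $p$-Rényi entropy if it has a density with respect to Lebesgue measure and its $p$-Rényi entropy is a finite number. Let $$\alpha=\left(1+\frac{1}{\log 2}\left(\frac{p+1}{p-1}\log\frac{p+1}{2p}+\frac{\log p}{p-1}\right)\right)^{-1}.$$ Let $X$ and $Y$ be independent random vectors in $\mathbb{R}^n$ such that $X$, $Y$ and $X+Y$ have finite $p$-Rényi entropies. Then $$N_p(X+Y)^{\alpha}\ge N_p(X)^{\alpha}+N_p(Y)^{\alpha}.$$ Moreover, $0<\alpha<\frac{p+1}{2}$. -/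

import Mathlib

open MeasureTheory ProbabilityTheory

/-- The `p`-Rényi entropy `h_p(X) = (1 / (1 - p)) * log ∫ f(x)^p dx` (for `p > 0`, `p ≠ 1`) of a
random vector `X` in `ℝⁿ` with density `f` with respect to Lebesgue measure, as an extended real
number. Here `log 0 = -∞` and `log ∞ = ∞`. -/
noncomputable def renyiEntropy {Ω : Type*} [MeasurableSpace Ω] {n : ℕ} (p : ℝ) (P : Measure Ω)
    (X : Ω → EuclideanSpace ℝ (Fin n)) : EReal :=
  ((1 / (1 - p) : ℝ) : EReal) * ENNReal.log (∫⁻ x, pdf X P volume x ^ p)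

/-- `X` has finite `p`-Rényi entropy: it has a density with respect to Lebesgue measure, and
`h_p(X)` is neither `-∞` nor `+∞`. -/
def HasFiniteRenyiEntropy {Ω : Type*} [MeasurableSpace Ω] {n : ℕ} (p : ℝ) (P : Measure Ω)
    (X : Ω → EuclideanSpace ℝ (Fin n)) : Prop :=
  HasPDF X P volume ∧ renyiEntropy p P X ≠ ⊥ ∧ renyiEntropy p P X ≠ ⊤

/-- The `p`-Rényi entropy power `N_p(X) = exp (2 h_p(X) / n)` of a random vector `X` in `ℝⁿ`, `n ≥ 1`,
with finite `p`-Rényi entropy. -/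
noncomputable def renyiEntropyPower {Ω : Type*} [MeasurableSpace Ω] {n : ℕ} (p : ℝ) (P : Measure Ω)
    (X : Ω → EuclideanSpace ℝ (Fin n)) : ℝ :=
  Real.exp (2 * (renyiEntropy p P X).toReal / n)

/-- The exponent `α = (1 + (1 / log 2) * ((p + 1) / (p - 1) * log ((p + 1) / (2 p))
+ log p / (p - 1)))⁻¹`. -/
noncomputable def renyiExponent (p : ℝ) : ℝ :=
  (1 + 1 / Real.log 2 *
    ((p + 1) / (p - 1) * Real.log ((p + 1) / (2 * p)) + Real.log p / (p - 1)))⁻¹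

section

open Set Filter Topology
open scoped ENNReal

/-! The inequality comes from the sharp Young inequality with one free parameter `l`, followed by an
optimisation over `l`.

Let `f` be the density of `X + Y`. Then `∫ f ^ p` is the expectation of `f ^ (p - 1)` at `X + Y`,
hence a trilinear integral. With `t = (p - 1) / p`, the Brascamp-Lieb form of Young's inequality for
`x`, `y`, `x + y` with `x₁ = l t`, `x₂ = (1 - l) t`, `x₃ = 1 / p` bounds it, and interpolation
between `L¹` and `Lᵖ` turns all norms into Rényi entropies. The result (`renyiEntropy_add_ge`) is
`h(X+Y) ≥ l h(X) + (1-l) h(Y)` plus a gain proportional to `-log (youngConst ..)`. Taking `l`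
proportional to `N_p(X) ^ α` gives the theorem as soon as `α` times the scaled gain dominates the
binary entropy of `l`.

The scaled gain is `D(1, l) - D(t, l) / t` with `D = entropyDeficit`, and `D(1, l)` is the binary
entropy. So the requirement is an upper bound for `D(t, l) / D(1, l)`. By `entropyDeficit_mul_le`
the extreme case is `l = 1/2`, and `α` is exactly the exponent giving equality there.

The sharp Young inequality is proved on the line by monotone transport to Gaussians
(`lintegral_rpow_mul_le_of_continuous`), then extended by approximation and induction on the
dimension. -/

/-! ### Monotone transport on the line. -/

theorem hasDerivAt_setIntegral_Iic {F : ℝ → ℝ} (hF : Continuous F) (hint : Integrable F) (x : ℝ) :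
    HasDerivAt (fun x => ∫ t in Iic x, F t) (F x) x := by
  have h : (fun x => ∫ t in Iic x, F t) = fun x => (∫ t in Iic 0, F t) + ∫ t in (0 : ℝ)..x, F t := by
    ext y
    rw [← intervalIntegral.integral_Iic_sub_Iic hint.integrableOn hint.integrableOn]
    ring
  rw [h]
  exact (intervalIntegral.integral_hasDerivAt_right (hF.intervalIntegrable _ _)
    (hF.stronglyMeasurableAtFilter _ _) hF.continuousAt).const_add _

theorem strictMono_setIntegral_Iic {F : ℝ → ℝ} (hF : Continuous F) (hpos : ∀ x, 0 < F x)
    (hint : Integrable F) : StrictMono fun x => ∫ t in Iic x, F t :=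
  strictMono_of_hasDerivAt_pos (hasDerivAt_setIntegral_Iic hF hint) hpos

theorem tendsto_setIntegral_Iic_atTop {F : ℝ → ℝ} (hint : Integrable F) :
    Tendsto (fun x => ∫ t in Iic x, F t) atTop (𝓝 (∫ t, F t)) :=
  (aecover_Iic tendsto_id).integral_tendsto_of_countably_generated hint

theorem tendsto_setIntegral_Iic_atBot {F : ℝ → ℝ} (hint : Integrable F) :
    Tendsto (fun x => ∫ t in Iic x, F t) atBot (𝓝 0) := by
  have h : Tendsto (fun x => ∫ t in Ioi x, F t) atBot (𝓝 (∫ t, F t)) :=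
    (aecover_Ioi tendsto_id).integral_tendsto_of_countably_generated hint
  have h2 : (fun x => ∫ t in Iic x, F t) = fun x => (∫ t, F t) - ∫ t in Ioi x, F t := by
    ext x
    rw [← integral_add_compl (measurableSet_Iic (a := x)) hint, compl_Iic]
    ring
  rw [h2]
  simpa using h.const_sub (∫ t, F t)

theorem range_setIntegral_Iic {F : ℝ → ℝ} (hF : Continuous F) (hpos : ∀ x, 0 < F x)
    (hint : Integrable F) : range (fun x => ∫ t in Iic x, F t) = Ioo 0 (∫ t, F t) := by
  have hmono := strictMono_setIntegral_Iic hF hpos hint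
  have hcont : Continuous fun x => ∫ t in Iic x, F t :=
    continuous_iff_continuousAt.2 fun x => (hasDerivAt_setIntegral_Iic hF hint x).continuousAt
  have htop := tendsto_setIntegral_Iic_atTop hint
  have hbot := tendsto_setIntegral_Iic_atBot hint
  apply Subset.antisymm
  · rintro _ ⟨x, rfl⟩
    exact ⟨(hmono.monotone.le_of_tendsto hbot (x - 1)).trans_lt (hmono (sub_one_lt x)),
      (hmono (lt_add_one x)).trans_le (hmono.monotone.ge_of_tendsto htop (x + 1))⟩
  · rintro y ⟨h0, h1⟩
    obtain ⟨a, ha⟩ := (hbot.eventually (gt_mem_nhds h0)).exists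
    obtain ⟨b, hb⟩ := (htop.eventually (lt_mem_nhds h1)).exists
    exact mem_range_of_exists_le_of_exists_ge hcont ⟨a, ha.le⟩ ⟨b, hb.le⟩

/-- Monotone transport between two positive continuous densities of equal mass on the line. -/
theorem exists_monotone_transport {F G : ℝ → ℝ} (hF : Continuous F) (hFpos : ∀ x, 0 < F x)
    (hFint : Integrable F) (hG : Continuous G) (hGpos : ∀ x, 0 < G x) (hGint : Integrable G)
    (hFG : ∫ x, F x = ∫ x, G x) :
    ∃ T T' : ℝ → ℝ, StrictMono T ∧ (∀ x, 0 < T' x) ∧ (∀ x, HasDerivAt T (T' x) x) ∧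
      ∀ x, F x = G (T x) * T' x := by
  have hFm := strictMono_setIntegral_Iic hF hFpos hFint
  have hGm := strictMono_setIntegral_Iic hG hGpos hGint
  have hFr := range_setIntegral_Iic hF hFpos hFint
  have hGr := range_setIntegral_Iic hG hGpos hGint
  -- Equal masses give both distribution functions the same range, so the inverse of one composed
  -- with the other is defined everywhere and is onto.
  have hex : ∀ x, ∃ t, ∫ s in Iic t, G s = ∫ s in Iic x, F s := fun x => by
    have : (∫ s in Iic x, F s) ∈ range fun t => ∫ s in Iic t, G s := by
      rw [hGr, ← hFG, ← hFr]; exact mem_range_self x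
    exact this
  choose T hT using hex
  have hTm : StrictMono T := fun x y hxy => hGm.lt_iff_lt.1 (by
    simp only [hT]; exact hFm hxy)
  have hTs : Function.Surjective T := fun t => by
    have : (∫ s in Iic t, G s) ∈ range fun x => ∫ s in Iic x, F s := by
      rw [hFr, hFG, ← hGr]; exact mem_range_self t
    obtain ⟨x, hx⟩ := this
    exact ⟨x, hGm.injective ((hT x).trans hx)⟩
  have hTc : Continuous T := hTm.monotone.continuous_of_surjective hTs
  -- The slope of `T` is the slope of `B` divided by the slope of `A` taken along `T`; continuity of
  -- `T` gives the limit of the latter.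
  have hderiv : ∀ x, HasDerivAt T (F x / G (T x)) x := fun x => by
    have hg := hasDerivAt_setIntegral_Iic hG hGint (T x)
    have hf := hasDerivAt_setIntegral_Iic hF hFint x
    set A := fun t => ∫ s in Iic t, G s
    set B := fun t => ∫ s in Iic t, F s
    have hAT : ∀ y, A (T y) = B y := hT
    rw [hasDerivAt_iff_tendsto_slope] at hf ⊢
    have h1 : Tendsto (fun y => slope A (T x) (T y)) (𝓝[≠] x) (𝓝 (G (T x))) := by
      refine (hasDerivAt_iff_tendsto_slope.1 hg).comp (tendsto_nhdsWithin_iff.2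
        ⟨hTc.continuousAt.tendsto.mono_left nhdsWithin_le_nhds, ?_⟩)
      filter_upwards [self_mem_nhdsWithin] with y hy using hTm.injective.ne hy
    refine (hf.div h1 (hGpos _).ne').congr' ?_
    filter_upwards [self_mem_nhdsWithin] with y hy
    have hne : B y - B x ≠ 0 := sub_ne_zero.2 (hFm.injective.ne hy)
    have hne' : T y - T x ≠ 0 := sub_ne_zero.2 (hTm.injective.ne hy)
    have hne2 : y - x ≠ 0 := sub_ne_zero.2 hy
    simp only [Pi.div_apply, slope_def_field, hAT]
    field_simp
  refine ⟨T, fun x => F x / G (T x), hTm, fun x => div_pos (hFpos _) (hGpos _), hderiv,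
    fun x => ?_⟩
  have := (hGpos (T x)).ne'
  field_simp

/-! ### Sharp Young inequality on the line for positive continuous functions. -/

/-- The sharp constant in the one-dimensional Brascamp-Lieb inequality for the three linear forms
`x`, `y`, `x + y`, with exponents `1 - x₁`, `1 - x₂`, `1 - x₃` where `x₁ + x₂ + x₃ = 1`. -/
noncomputable def youngConst (x₁ x₂ x₃ : ℝ) : ℝ :=
  √(x₁ ^ x₁ * x₂ ^ x₂ * x₃ ^ x₃ / ((1 - x₁) ^ (1 - x₁) * (1 - x₂) ^ (1 - x₂) * (1 - x₃) ^ (1 - x₃)))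

theorem lintegral_gaussian {b : ℝ} (hb : 0 < b) :
    ∫⁻ x : ℝ, ENNReal.ofReal (Real.exp (-b * x ^ 2)) = ENNReal.ofReal √(Real.pi / b) := by
  rw [← integral_gaussian, ofReal_integral_eq_lintegral_ofReal (integrable_exp_neg_mul_sq hb)
    (Eventually.of_forall fun x => (Real.exp_pos _).le)]

theorem lintegral_gaussian_prod {A B C : ℝ} (hC : 0 < C) (hD : 0 < A * C - B ^ 2) :
    ∫⁻ z : ℝ × ℝ, ENNReal.ofReal (Real.exp (-(A * z.1 ^ 2 - 2 * B * z.1 * z.2 + C * z.2 ^ 2)))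
      = ENNReal.ofReal (Real.pi / √(A * C - B ^ 2)) := by
  rw [Measure.volume_eq_prod, lintegral_prod _ (by fun_prop)]
  have h : ∀ u v : ℝ, ENNReal.ofReal (Real.exp (-(A * u ^ 2 - 2 * B * u * v + C * v ^ 2)))
      = ENNReal.ofReal (Real.exp (-((A * C - B ^ 2) / C) * u ^ 2)) *
        ENNReal.ofReal (Real.exp (-C * (v - B * u / C) ^ 2)) := fun u v => by
    rw [← ENNReal.ofReal_mul (Real.exp_pos _).le, ← Real.exp_add]
    congr 2
    field_simp
    ring
  simp only [h]
  have h2 : ∀ u : ℝ, ∫⁻ v : ℝ, ENNReal.ofReal (Real.exp (-((A * C - B ^ 2) / C) * u ^ 2)) *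
        ENNReal.ofReal (Real.exp (-C * (v - B * u / C) ^ 2)) =
      ENNReal.ofReal (Real.exp (-((A * C - B ^ 2) / C) * u ^ 2)) *
        ENNReal.ofReal √(Real.pi / C) := fun u => by
    rw [lintegral_const_mul _ (by fun_prop),
      lintegral_sub_right_eq_self (fun v => ENNReal.ofReal (Real.exp (-C * v ^ 2))) (B * u / C),
      lintegral_gaussian hC]
  simp only [h2]
  rw [lintegral_mul_const _ (by fun_prop), lintegral_gaussian (div_pos hD hC),
    ← ENNReal.ofReal_mul (Real.sqrt_nonneg _), ← Real.sqrt_mul (by positivity)]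
  congr 1
  rw [show Real.pi / ((A * C - B ^ 2) / C) * (Real.pi / C) = Real.pi ^ 2 / (A * C - B ^ 2) by
    field_simp, Real.sqrt_div (by positivity), Real.sqrt_sq Real.pi_pos.le]

theorem hasFDerivAt_transport_prod {S T U : ℝ → ℝ} {S' T' U' : ℝ} (a b c : ℝ) (z : ℝ × ℝ)
    (hS : HasDerivAt S S' z.1) (hT : HasDerivAt T T' z.2) (hU : HasDerivAt U U' (z.1 + z.2)) :
    HasFDerivAt (fun z : ℝ × ℝ => (a * S z.1 + c * U (z.1 + z.2), b * T z.2 + c * U (z.1 + z.2)))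
      (LinearMap.toContinuousLinearMap (Matrix.toLin (Module.Basis.finTwoProd ℝ)
        (Module.Basis.finTwoProd ℝ) !![a * S' + c * U', c * U'; c * U', b * T' + c * U'])) z := by
  rw [Matrix.toLin_finTwoProd_toContinuousLinearMap]
  have h1 : HasFDerivAt (fun z : ℝ × ℝ => S z.1) (S' • ContinuousLinearMap.fst ℝ ℝ ℝ) z :=
    hS.comp_hasFDerivAt z hasFDerivAt_fst
  have h2 : HasFDerivAt (fun z : ℝ × ℝ => T z.2) (T' • ContinuousLinearMap.snd ℝ ℝ ℝ) z :=
    hT.comp_hasFDerivAt z hasFDerivAt_snd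
  have h3 : HasFDerivAt (fun z : ℝ × ℝ => U (z.1 + z.2))
      (U' • (ContinuousLinearMap.fst ℝ ℝ ℝ + ContinuousLinearMap.snd ℝ ℝ ℝ)) z :=
    hU.comp_hasFDerivAt z (hasFDerivAt_fst.add hasFDerivAt_snd)
  refine (((h1.const_mul a).add (h3.const_mul c)).prodMk
    ((h2.const_mul b).add (h3.const_mul c))).congr_fderiv ?_
  ext <;> simp

/-- If `x < x'`, equal first coordinates force `x + y > x' + y'`, hence `y > y'`, and then the
second coordinates cannot agree. -/
theorem injective_transport_prod {S T U : ℝ → ℝ} (hS : StrictMono S) (hT : StrictMono T)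
    (hU : StrictMono U) {a b c : ℝ} (ha : 0 < a) (hb : 0 < b) (hc : 0 < c) :
    Function.Injective
      (fun z : ℝ × ℝ => (a * S z.1 + c * U (z.1 + z.2), b * T z.2 + c * U (z.1 + z.2))) := by
  have key : ∀ x y x' y' : ℝ, a * S x + c * U (x + y) = a * S x' + c * U (x' + y') →
      b * T y + c * U (x + y) = b * T y' + c * U (x' + y') → ¬ x < x' := by
    intro x y x' y' h1 h2 hlt
    have e1 := mul_lt_mul_of_pos_left (hS hlt) ha
    have e2 : x' + y' < x + y := hU.lt_iff_lt.1 (lt_of_mul_lt_mul_left (by linarith) hc.le)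
    have e3 := mul_lt_mul_of_pos_left (hT (show y' < y by linarith)) hb
    have e4 := mul_lt_mul_of_pos_left (hU e2) hc
    linarith
  rintro ⟨x, y⟩ ⟨x', y'⟩ h
  simp only [Prod.mk.injEq] at h
  have hx : x = x' := le_antisymm (not_lt.1 (key _ _ _ _ h.1.symm h.2.symm))
    (not_lt.1 (key _ _ _ _ h.1 h.2))
  subst hx
  have : U (x + y) = U (x + y') := mul_left_cancel₀ hc.ne' (add_left_cancel h.1)
  simpa using hU.injective this

/-- Weighted AM-GM for `s t`, `s u`, `t u` with weights `x₃`, `x₂`, `x₁`. Up to the factor `x₁ x₂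
x₃`, the right side is the Jacobian of the transport map of the plane. -/
theorem prod_rpow_le_jacobian {x₁ x₂ x₃ s t u : ℝ} (h₁ : 0 < x₁) (h₂ : 0 < x₂) (h₃ : 0 < x₃)
    (hx : x₁ + x₂ + x₃ = 1) (hs : 0 < s) (ht : 0 < t) (hu : 0 < u) :
    s ^ (1 - x₁) * t ^ (1 - x₂) * u ^ (1 - x₃) ≤
      x₃ * s * t + x₂ * s * u + x₁ * t * u := by
  have h := Real.geom_mean_le_arith_mean3_weighted h₃.le h₂.le h₁.le
    (mul_pos hs ht).le (mul_pos hs hu).le (mul_pos ht hu).le (by linarith)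
  calc s ^ (1 - x₁) * t ^ (1 - x₂) * u ^ (1 - x₃)
      = (s * t) ^ x₃ * (s * u) ^ x₂ * (t * u) ^ x₁ := by
        rw [show 1 - x₁ = x₃ + x₂ by linarith, show 1 - x₂ = x₃ + x₁ by linarith,
          show 1 - x₃ = x₂ + x₁ by linarith, Real.rpow_add hs, Real.rpow_add ht, Real.rpow_add hu,
          Real.mul_rpow hs.le ht.le, Real.mul_rpow hs.le hu.le, Real.mul_rpow ht.le hu.le]
        ring
    _ ≤ _ := by linarith

/-- Collects the Gaussian normalisations, the Jacobian factor and the final planar Gaussian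
integral. The powers of `π` cancel because the exponents `1 - xᵢ` sum to 2. -/
theorem youngConst_eq {x₁ x₂ x₃ : ℝ} (h₁ : 0 < x₁) (h₂ : 0 < x₂) (h₃ : 0 < x₃)
    (hx : x₁ + x₂ + x₃ = 1) :
    √(1 / (x₁ * (1 - x₁)) / Real.pi) ^ (1 - x₁) * √(1 / (x₂ * (1 - x₂)) / Real.pi) ^ (1 - x₂) *
      √(1 / (x₃ * (1 - x₃)) / Real.pi) ^ (1 - x₃) * (x₁ * x₂ * x₃) *
        (Real.pi / √(x₁ * x₂ * x₃)) = youngConst x₁ x₂ x₃ := by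
  have hc₁ : 0 < 1 - x₁ := by linarith
  have hc₂ : 0 < 1 - x₂ := by linarith
  have hc₃ : 0 < 1 - x₃ := by linarith
  have hπ := Real.pi_pos
  unfold youngConst
  refine Real.log_injOn_pos (mem_Ioi.2 (by positivity)) (mem_Ioi.2 (by positivity)) ?_
  have e1 := h₁.ne'; have e2 := h₂.ne'; have e3 := h₃.ne'
  have d1 := hc₁.ne'; have d2 := hc₂.ne'; have d3 := hc₃.ne'
  have hlog : ∀ x : ℝ, 0 < x → 0 < 1 - x → Real.log (√(1 / (x * (1 - x)) / Real.pi) ^ (1 - x)) =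
      (1 - x) * ((- (Real.log x + Real.log (1 - x)) - Real.log Real.pi) / 2) := fun x hx hx' => by
    rw [Real.log_rpow (by positivity), Real.log_sqrt (by positivity),
      Real.log_div (by positivity) hπ.ne', one_div, Real.log_inv, Real.log_mul hx.ne' hx'.ne']
  rw [Real.log_sqrt (by positivity), Real.log_div (by positivity) (by positivity),
    Real.log_mul (by positivity) (by positivity), Real.log_mul (by positivity) (by positivity),
    Real.log_mul (by positivity) (by positivity), Real.log_mul (by positivity) (by positivity),
    hlog _ h₁ hc₁, hlog _ h₂ hc₂, hlog _ h₃ hc₃, Real.log_div hπ.ne' (by positivity),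
    Real.log_sqrt (by positivity), Real.log_mul (by positivity) (by positivity),
    Real.log_mul (by positivity) (by positivity),
    Real.log_mul (by positivity) (by positivity), Real.log_mul (by positivity) (by positivity),
    Real.log_mul (by positivity) (by positivity), Real.log_mul (by positivity) (by positivity),
    Real.log_rpow h₁, Real.log_rpow h₂, Real.log_rpow h₃, Real.log_rpow hc₁, Real.log_rpow hc₂,
    Real.log_rpow hc₃]
  linear_combination (Real.log Real.pi / 2) * hx

theorem lintegral_rpow_mul_le_of_continuous {x₁ x₂ x₃ : ℝ} (h₁ : 0 < x₁) (h₂ : 0 < x₂)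
    (h₃ : 0 < x₃) (hx : x₁ + x₂ + x₃ = 1) {F G H : ℝ → ℝ}
    (hF : Continuous F) (hFpos : ∀ x, 0 < F x) (hFint : Integrable F)
    (hG : Continuous G) (hGpos : ∀ x, 0 < G x) (hGint : Integrable G)
    (hH : Continuous H) (hHpos : ∀ x, 0 < H x) (hHint : Integrable H) :
    ∫⁻ z : ℝ × ℝ, ENNReal.ofReal (F z.1 ^ (1 - x₁) * G z.2 ^ (1 - x₂) * H (z.1 + z.2) ^ (1 - x₃)) ≤
      ENNReal.ofReal (youngConst x₁ x₂ x₃ *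
        ((∫ x, F x) ^ (1 - x₁) * (∫ x, G x) ^ (1 - x₂) * (∫ x, H x) ^ (1 - x₃))) := by
  have hc₁ : 0 < 1 - x₁ := by linarith
  have hc₂ : 0 < 1 - x₂ := by linarith
  have hc₃ : 0 < 1 - x₃ := by linarith
  have hπ := Real.pi_pos
  have transport : ∀ (x : ℝ) (F : ℝ → ℝ), 0 < x → 0 < 1 - x → Continuous F → (∀ t, 0 < F t) →
      Integrable F → ∃ T T' : ℝ → ℝ, StrictMono T ∧ (∀ t, 0 < T' t) ∧
        (∀ t, HasDerivAt T (T' t) t) ∧ 0 ≤ ∫ t, F t ∧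
        ∀ t, F t ^ (1 - x) = (∫ t, F t) ^ (1 - x) * √(1 / (x * (1 - x)) / Real.pi) ^ (1 - x) *
          Real.exp (-(T t ^ 2 / x)) * T' t ^ (1 - x) := by
    intro x F hx hx' hF hFpos hFint
    have hI : 0 < ∫ t, F t :=
      (integral_pos_iff_support_of_nonneg (fun t => (hFpos t).le) hFint).2 (by
        rw [show Function.support F = univ from eq_univ_of_forall fun t => (hFpos t).ne']
        simp)
    -- This Gaussian parameter makes the power `1 - x` of the target density a multiple of `exp (-T²
    -- / x)`.
    have hb : 0 < 1 / (x * (1 - x)) := by positivity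
    set b := 1 / (x * (1 - x)) with hbdef
    have hN : 0 < √(b / Real.pi) := by positivity
    obtain ⟨T, T', hT, hT', hd, he⟩ := exists_monotone_transport hF hFpos hFint
      (G := fun t => ((∫ t, F t) * √(b / Real.pi)) * Real.exp (-b * t ^ 2)) (by fun_prop)
      (fun t => by positivity) ((integrable_exp_neg_mul_sq hb).const_mul _) (by
        rw [integral_const_mul, integral_gaussian, mul_assoc, ← Real.sqrt_mul (by positivity),
          show b / Real.pi * (Real.pi / b) = 1 by field_simp]
        simp)
    refine ⟨T, T', hT, hT', hd, hI.le, fun t => ?_⟩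
    rw [he t, Real.mul_rpow (by positivity) (hT' t).le, Real.mul_rpow (by positivity)
      (Real.exp_pos _).le, Real.mul_rpow hI.le hN.le, ← Real.exp_mul]
    congr 3
    rw [hbdef]
    field_simp
  obtain ⟨S, S', hS, hSpos, hSd, hIF, hSe⟩ := transport x₁ F h₁ hc₁ hF hFpos hFint
  obtain ⟨T, T', hT, hTpos, hTd, hIG, hTe⟩ := transport x₂ G h₂ hc₂ hG hGpos hGint
  obtain ⟨U, U', hU, hUpos, hUd, hIH, hUe⟩ := transport x₃ H h₃ hc₃ hH hHpos hHint
  set Φ : ℝ × ℝ → ℝ × ℝ := fun z =>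
    (x₁⁻¹ * S z.1 + x₃⁻¹ * U (z.1 + z.2), x₂⁻¹ * T z.2 + x₃⁻¹ * U (z.1 + z.2)) with hΦ
  -- `Q w` is the minimum of `s²/x₁ + t²/x₂ + u²/x₃` over all `(s, t, u)` with `s/x₁ + u/x₃ = w.1`
  -- and `t/x₂ + u/x₃ = w.2`; the excess over the minimum is `(s + t - u)²`.
  set Q : ℝ × ℝ → ℝ := fun w =>
    x₁ * (1 - x₁) * w.1 ^ 2 - 2 * (x₁ * x₂) * w.1 * w.2 + x₂ * (1 - x₂) * w.2 ^ 2 with hQ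
  set M : ℝ := (∫ x, F x) ^ (1 - x₁) * (∫ x, G x) ^ (1 - x₂) * (∫ x, H x) ^ (1 - x₃) with hM
  set N : ℝ := √(1 / (x₁ * (1 - x₁)) / Real.pi) ^ (1 - x₁) *
    √(1 / (x₂ * (1 - x₂)) / Real.pi) ^ (1 - x₂) * √(1 / (x₃ * (1 - x₃)) / Real.pi) ^ (1 - x₃)
    with hN
  have hMpos : 0 ≤ M := by positivity
  have hNpos : 0 ≤ N := by positivity
  set D : ℝ × ℝ → (ℝ × ℝ →L[ℝ] ℝ × ℝ) := fun z => LinearMap.toContinuousLinearMap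
    (Matrix.toLin (Module.Basis.finTwoProd ℝ) (Module.Basis.finTwoProd ℝ)
      !![x₁⁻¹ * S' z.1 + x₃⁻¹ * U' (z.1 + z.2), x₃⁻¹ * U' (z.1 + z.2);
        x₃⁻¹ * U' (z.1 + z.2), x₂⁻¹ * T' z.2 + x₃⁻¹ * U' (z.1 + z.2)]) with hD
  have hdet : ∀ z, (D z).det = (x₃ * S' z.1 * T' z.2 + x₂ * S' z.1 * U' (z.1 + z.2) +
      x₁ * T' z.2 * U' (z.1 + z.2)) / (x₁ * x₂ * x₃) := fun z => by
    simp only [hD, LinearMap.det_toContinuousLinearMap, LinearMap.det_toLin, Matrix.det_fin_two_of]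
    field_simp
    ring
  have hpt : ∀ z : ℝ × ℝ,
      F z.1 ^ (1 - x₁) * G z.2 ^ (1 - x₂) * H (z.1 + z.2) ^ (1 - x₃) ≤
        M * N * (x₁ * x₂ * x₃) * (|(D z).det| * Real.exp (-Q (Φ z))) := fun z => by
    have hs := hSpos z.1
    have ht := hTpos z.2
    have hu := hUpos (z.1 + z.2)
    have hj := prod_rpow_le_jacobian h₁ h₂ h₃ hx hs ht hu
    have hQle : Q (Φ z) ≤ S z.1 ^ 2 / x₁ + T z.2 ^ 2 / x₂ + U (z.1 + z.2) ^ 2 / x₃ := by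
      have : S z.1 ^ 2 / x₁ + T z.2 ^ 2 / x₂ + U (z.1 + z.2) ^ 2 / x₃ - Q (Φ z)
          = (S z.1 + T z.2 - U (z.1 + z.2)) ^ 2 := by
        simp only [hQ, hΦ]
        obtain rfl : x₃ = 1 - x₁ - x₂ := by linarith
        field_simp
        ring
      nlinarith [sq_nonneg (S z.1 + T z.2 - U (z.1 + z.2))]
    rw [hdet, abs_of_pos (by positivity), hSe, hTe, hUe]
    calc _ = M * N * (Real.exp (-(S z.1 ^ 2 / x₁ + T z.2 ^ 2 / x₂ + U (z.1 + z.2) ^ 2 / x₃)) *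
          (S' z.1 ^ (1 - x₁) * T' z.2 ^ (1 - x₂) * U' (z.1 + z.2) ^ (1 - x₃))) := by
          rw [neg_add, neg_add, Real.exp_add, Real.exp_add, hM, hN]
          ring
      _ ≤ M * N * (Real.exp (-Q (Φ z)) * (x₃ * S' z.1 * T' z.2 + x₂ * S' z.1 * U' (z.1 + z.2) +
            x₁ * T' z.2 * U' (z.1 + z.2))) := by
          gcongr
      _ = _ := by
          field_simp
  calc _ ≤ ∫⁻ z : ℝ × ℝ, ENNReal.ofReal (M * N * (x₁ * x₂ * x₃)) *
        (ENNReal.ofReal |(D z).det| * ENNReal.ofReal (Real.exp (-Q (Φ z)))) := by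
        refine lintegral_mono fun z => ?_
        rw [← ENNReal.ofReal_mul (abs_nonneg _), ← ENNReal.ofReal_mul (by positivity)]
        exact ENNReal.ofReal_le_ofReal (hpt z)
    _ = ENNReal.ofReal (M * N * (x₁ * x₂ * x₃)) * ∫⁻ z : ℝ × ℝ,
        (ENNReal.ofReal |(D z).det| * ENNReal.ofReal (Real.exp (-Q (Φ z)))) := by
        rw [lintegral_const_mul' _ _ ENNReal.ofReal_ne_top]
    _ = ENNReal.ofReal (M * N * (x₁ * x₂ * x₃)) * ∫⁻ w in Φ '' univ,
        ENNReal.ofReal (Real.exp (-Q w)) := by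
        rw [lintegral_image_eq_lintegral_abs_det_fderiv_mul volume MeasurableSet.univ
          (fun z _ => (hasFDerivAt_transport_prod _ _ _ z (hSd _) (hTd _)
            (hUd _)).hasFDerivWithinAt)
          (injective_transport_prod hS hT hU (inv_pos.2 h₁) (inv_pos.2 h₂)
            (inv_pos.2 h₃)).injOn (fun w => ENNReal.ofReal (Real.exp (-Q w))),
          setLIntegral_univ]
    -- Surjectivity of `Φ` is not needed: enlarging its image to the whole plane only increases the
    -- integral.
    _ ≤ ENNReal.ofReal (M * N * (x₁ * x₂ * x₃)) * ∫⁻ w, ENNReal.ofReal (Real.exp (-Q w)) := by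
        gcongr
        exact Measure.restrict_le_self
    _ = _ := by
        have hdisc : x₁ * (1 - x₁) * (x₂ * (1 - x₂)) - (x₁ * x₂) ^ 2 = x₁ * x₂ * x₃ := by
          obtain rfl : x₃ = 1 - x₁ - x₂ := by linarith
          ring
        rw [lintegral_gaussian_prod (by positivity) (by rw [hdisc]; positivity), hdisc,
          ← ENNReal.ofReal_mul (by positivity), ← youngConst_eq h₁ h₂ h₃ hx]
        congr 1
        ring

/-! ### Extension to measurable functions and to higher dimension. -/

/-- An integrable nonnegative function is the limit, in `L¹` and almost everywhere, of positive
continuous integrable functions. -/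
theorem exists_seq_continuous_pos_tendsto {f : ℝ → ℝ} (hf : Integrable f) (hf0 : ∀ x, 0 ≤ f x) :
    ∃ F : ℕ → ℝ → ℝ, (∀ k, Continuous (F k)) ∧ (∀ k x, 0 < F k x) ∧ (∀ k, Integrable (F k)) ∧
      (∀ᵐ x, Tendsto (fun k => F k x) atTop (𝓝 (f x))) ∧
      Tendsto (fun k => ∫ x, F k x) atTop (𝓝 (∫ x, f x)) := by
  have hε : ∀ k : ℕ, ENNReal.ofReal (1 / ((k : ℝ) + 1)) ≠ 0 := fun k => by
    rw [Ne, ENNReal.ofReal_eq_zero, not_le]; positivity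
  choose g _ hgle hgc hgi using fun k : ℕ => hf.exists_hasCompactSupport_lintegral_sub_le (hε k)
  have hγ : Integrable fun x : ℝ => Real.exp (-1 * x ^ 2) := integrable_exp_neg_mul_sq one_pos
  -- The absolute value brings `g k` no further from the nonnegative `f`, and the small Gaussian
  -- makes the result strictly positive.
  set F : ℕ → ℝ → ℝ := fun k x => |g k x| + 1 / ((k : ℝ) + 1) * Real.exp (-1 * x ^ 2) with hF
  have hFc : ∀ k, Continuous (F k) := fun k => by
    have := hgc k
    fun_prop
  have hFpos : ∀ k x, 0 < F k x := fun k x => by positivity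
  have hFi : ∀ k, Integrable (F k) := fun k => (hgi k).abs.add (hγ.const_mul _)
  have hlim : Tendsto (fun k : ℕ => ENNReal.ofReal (1 / ((k : ℝ) + 1)) +
      ENNReal.ofReal (1 / ((k : ℝ) + 1)) * ∫⁻ x : ℝ, ENNReal.ofReal (Real.exp (-1 * x ^ 2)))
      atTop (𝓝 0) := by
    have h0 : Tendsto (fun k : ℕ => ENNReal.ofReal (1 / ((k : ℝ) + 1))) atTop (𝓝 0) := by
      simpa using ENNReal.tendsto_ofReal (tendsto_one_div_add_atTop_nhds_zero_nat (𝕜 := ℝ))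
    have := h0.add (ENNReal.Tendsto.mul_const h0 (b := ∫⁻ x : ℝ,
      ENNReal.ofReal (Real.exp (-1 * x ^ 2))) (Or.inr (by
        rw [lintegral_gaussian one_pos]; exact ENNReal.ofReal_ne_top)))
    simpa using this
  have hle : ∀ k, ∫⁻ x, ‖F k x - f x‖ₑ ≤ ENNReal.ofReal (1 / ((k : ℝ) + 1)) +
      ENNReal.ofReal (1 / ((k : ℝ) + 1)) *
        ∫⁻ x : ℝ, ENNReal.ofReal (Real.exp (-1 * x ^ 2)) := fun k => by
    calc ∫⁻ x, ‖F k x - f x‖ₑ ≤ ∫⁻ x, (‖f x - g k x‖ₑ +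
          ENNReal.ofReal (1 / ((k : ℝ) + 1)) * ENNReal.ofReal (Real.exp (-1 * x ^ 2))) := by
          refine lintegral_mono fun x => ?_
          rw [← ENNReal.ofReal_mul (by positivity), ← ofReal_norm, ← ofReal_norm,
            ← ENNReal.ofReal_add (norm_nonneg _) (by positivity)]
          refine ENNReal.ofReal_le_ofReal ?_
          rw [Real.norm_eq_abs, Real.norm_eq_abs]
          have h1 : |(|g k x| - f x)| ≤ |f x - g k x| := by
            have := abs_abs_sub_abs_le (g k x) (f x)
            rwa [abs_of_nonneg (hf0 x), abs_sub_comm (g k x)] at this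
          calc |F k x - f x| = |(|g k x| - f x) + 1 / ((k : ℝ) + 1) * Real.exp (-1 * x ^ 2)| := by
                congr 1; simp only [hF]; ring
            _ ≤ _ := (abs_add_le _ _).trans (add_le_add h1 (abs_of_nonneg (by positivity)).le)
      _ ≤ _ := by
          rw [lintegral_add_right _ (by fun_prop), lintegral_const_mul _ (by fun_prop)]
          gcongr
          exact hgle k
  have hL1 : Tendsto (fun k => ∫⁻ x, ‖F k x - f x‖ₑ) atTop (𝓝 0) :=
    tendsto_of_tendsto_of_tendsto_of_le_of_le tendsto_const_nhds hlim (fun _ => zero_le) hle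
  have hmeas : TendstoInMeasure volume F atTop f :=
    tendstoInMeasure_of_tendsto_eLpNorm one_ne_zero (fun k => (hFi k).aestronglyMeasurable)
      hf.aestronglyMeasurable (by simpa only [eLpNorm_one_eq_lintegral_enorm, Pi.sub_apply] using hL1)
  obtain ⟨ns, hns, hae⟩ := hmeas.exists_seq_tendsto_ae
  exact ⟨fun k => F (ns k), fun k => hFc _, fun k => hFpos _, fun k => hFi _, hae,
    (tendsto_integral_of_L1 f hf.aestronglyMeasurable (Eventually.of_forall hFi) hL1).comp
      hns.tendsto_atTop⟩

theorem quasiMeasurePreserving_add_prod :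
    Measure.QuasiMeasurePreserving (fun z : ℝ × ℝ => z.1 + z.2) volume volume :=
  (Measure.quasiMeasurePreserving_snd (μ := (volume : Measure ℝ)) (ν := volume)).comp
    (measurePreserving_prod_add volume volume).quasiMeasurePreserving

/-- Fatou's lemma: almost everywhere convergence of the integrand and convergence of the three
integrals suffice. -/
theorem lintegral_rpow_mul_le_of_integrable {x₁ x₂ x₃ : ℝ} (h₁ : 0 < x₁) (h₂ : 0 < x₂)
    (h₃ : 0 < x₃) (hx : x₁ + x₂ + x₃ = 1) {f g h : ℝ → ℝ}
    (hf : Integrable f) (hf0 : ∀ x, 0 ≤ f x) (hg : Integrable g) (hg0 : ∀ x, 0 ≤ g x)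
    (hh : Integrable h) (hh0 : ∀ x, 0 ≤ h x) :
    ∫⁻ z : ℝ × ℝ, ENNReal.ofReal (f z.1 ^ (1 - x₁) * g z.2 ^ (1 - x₂) * h (z.1 + z.2) ^ (1 - x₃)) ≤
      ENNReal.ofReal (youngConst x₁ x₂ x₃ *
        ((∫ x, f x) ^ (1 - x₁) * (∫ x, g x) ^ (1 - x₂) * (∫ x, h x) ^ (1 - x₃))) := by
  obtain ⟨F, hFc, hFpos, hFi, hFae, hFlim⟩ := exists_seq_continuous_pos_tendsto hf hf0
  obtain ⟨G, hGc, hGpos, hGi, hGae, hGlim⟩ := exists_seq_continuous_pos_tendsto hg hg0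
  obtain ⟨H, hHc, hHpos, hHi, hHae, hHlim⟩ := exists_seq_continuous_pos_tendsto hh hh0
  have hc₁ : 0 ≤ 1 - x₁ := by linarith
  have hc₂ : 0 ≤ 1 - x₂ := by linarith
  have hc₃ : 0 ≤ 1 - x₃ := by linarith
  have hFae' : ∀ᵐ z : ℝ × ℝ, Tendsto (fun k => F k z.1) atTop (𝓝 (f z.1)) :=
    (Measure.quasiMeasurePreserving_fst (μ := (volume : Measure ℝ)) (ν := volume)).ae hFae
  have hGae' : ∀ᵐ z : ℝ × ℝ, Tendsto (fun k => G k z.2) atTop (𝓝 (g z.2)) :=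
    (Measure.quasiMeasurePreserving_snd (μ := (volume : Measure ℝ)) (ν := volume)).ae hGae
  have hHae' : ∀ᵐ z : ℝ × ℝ, Tendsto (fun k => H k (z.1 + z.2)) atTop (𝓝 (h (z.1 + z.2))) :=
    quasiMeasurePreserving_add_prod.ae hHae
  calc _ = ∫⁻ z : ℝ × ℝ, liminf (fun k => ENNReal.ofReal
        (F k z.1 ^ (1 - x₁) * G k z.2 ^ (1 - x₂) * H k (z.1 + z.2) ^ (1 - x₃))) atTop := by
        refine lintegral_congr_ae ?_
        filter_upwards [hFae', hGae', hHae'] with z h1 h2 h3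
        exact (ENNReal.tendsto_ofReal (((h1.rpow_const (Or.inr hc₁)).mul
          (h2.rpow_const (Or.inr hc₂))).mul (h3.rpow_const (Or.inr hc₃)))).liminf_eq.symm
    _ ≤ liminf (fun k => ∫⁻ z : ℝ × ℝ, ENNReal.ofReal
        (F k z.1 ^ (1 - x₁) * G k z.2 ^ (1 - x₂) * H k (z.1 + z.2) ^ (1 - x₃))) atTop :=
        lintegral_liminf_le fun k => by
          have e1 := (hFc k).measurable
          have e2 := (hGc k).measurable
          have e3 := (hHc k).measurable
          fun_prop
    _ ≤ liminf (fun k => ENNReal.ofReal (youngConst x₁ x₂ x₃ * ((∫ x, F k x) ^ (1 - x₁) *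
          (∫ x, G k x) ^ (1 - x₂) * (∫ x, H k x) ^ (1 - x₃)))) atTop :=
        liminf_le_liminf (Eventually.of_forall fun k => lintegral_rpow_mul_le_of_continuous h₁ h₂ h₃
          hx (hFc k) (hFpos k) (hFi k) (hGc k) (hGpos k) (hGi k) (hHc k) (hHpos k) (hHi k))
    _ = _ :=
        (ENNReal.tendsto_ofReal ((((hFlim.rpow_const (Or.inr hc₁)).mul
          (hGlim.rpow_const (Or.inr hc₂))).mul
            (hHlim.rpow_const (Or.inr hc₃))).const_mul _)).liminf_eq

/-- The sharp Brascamp-Lieb form of Young's convolution inequality on the line. -/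
theorem lintegral_rpow_mul_le {x₁ x₂ x₃ : ℝ} (h₁ : 0 < x₁) (h₂ : 0 < x₂)
    (h₃ : 0 < x₃) (hx : x₁ + x₂ + x₃ = 1) {F G H : ℝ → ℝ≥0∞}
    (hF : Measurable F) (hG : Measurable G) (hH : Measurable H) :
    ∫⁻ x, ∫⁻ y, F x ^ (1 - x₁) * G y ^ (1 - x₂) * H (x + y) ^ (1 - x₃) ≤
      ENNReal.ofReal (youngConst x₁ x₂ x₃) *
        ((∫⁻ x, F x) ^ (1 - x₁) * (∫⁻ x, G x) ^ (1 - x₂) * (∫⁻ x, H x) ^ (1 - x₃)) := by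
  have hc₁ : 0 < 1 - x₁ := by linarith
  have hc₂ : 0 < 1 - x₂ := by linarith
  have hc₃ : 0 < 1 - x₃ := by linarith
  have hK : 0 < youngConst x₁ x₂ x₃ := by unfold youngConst; positivity
  rw [← lintegral_prod (fun z : ℝ × ℝ => F z.1 ^ (1 - x₁) * G z.2 ^ (1 - x₂) *
    H (z.1 + z.2) ^ (1 - x₃)) (by fun_prop), ← Measure.volume_eq_prod]
  -- Vanishing integrals come first: since `0 * ∞ = 0`, an infinite integral makes the bound
  -- infinite only when the other factors are nonzero.
  by_cases hF0 : ∫⁻ x, F x = 0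
  · have : ∀ᵐ z : ℝ × ℝ, F z.1 = 0 :=
      (Measure.quasiMeasurePreserving_fst (μ := (volume : Measure ℝ)) (ν := volume)).ae
        ((lintegral_eq_zero_iff hF).1 hF0)
    rw [lintegral_congr_ae (g := 0)
      (by filter_upwards [this] with z hz; simp [hz, ENNReal.zero_rpow_of_pos hc₁])]
    simp
  by_cases hG0 : ∫⁻ x, G x = 0
  · have : ∀ᵐ z : ℝ × ℝ, G z.2 = 0 :=
      (Measure.quasiMeasurePreserving_snd (μ := (volume : Measure ℝ)) (ν := volume)).ae
        ((lintegral_eq_zero_iff hG).1 hG0)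
    rw [lintegral_congr_ae (g := 0)
      (by filter_upwards [this] with z hz; simp [hz, ENNReal.zero_rpow_of_pos hc₂])]
    simp
  by_cases hH0 : ∫⁻ x, H x = 0
  · have : ∀ᵐ z : ℝ × ℝ, H (z.1 + z.2) = 0 :=
      quasiMeasurePreserving_add_prod.ae ((lintegral_eq_zero_iff hH).1 hH0)
    rw [lintegral_congr_ae (g := 0)
      (by filter_upwards [this] with z hz; simp [hz, ENNReal.zero_rpow_of_pos hc₃])]
    simp
  have hK0 : ENNReal.ofReal (youngConst x₁ x₂ x₃) ≠ 0 := by simpa using hK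
  have hF1 : (∫⁻ x, F x) ^ (1 - x₁) ≠ 0 := by simp [hF0, (sub_pos.1 hc₁).le]
  have hG1 : (∫⁻ x, G x) ^ (1 - x₂) ≠ 0 := by simp [hG0, (sub_pos.1 hc₂).le]
  have hH1 : (∫⁻ x, H x) ^ (1 - x₃) ≠ 0 := by simp [hH0, (sub_pos.1 hc₃).le]
  by_cases hFt : ∫⁻ x, F x = ∞
  · rw [hFt, ENNReal.top_rpow_of_pos hc₁, ENNReal.top_mul hG1, ENNReal.top_mul hH1,
      ENNReal.mul_top hK0]
    exact le_top
  by_cases hGt : ∫⁻ x, G x = ∞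
  · rw [hGt, ENNReal.top_rpow_of_pos hc₂, ENNReal.mul_top hF1, ENNReal.top_mul hH1,
      ENNReal.mul_top hK0]
    exact le_top
  by_cases hHt : ∫⁻ x, H x = ∞
  · rw [hHt, ENNReal.top_rpow_of_pos hc₃, ENNReal.mul_top (mul_ne_zero hF1 hG1),
      ENNReal.mul_top hK0]
    exact le_top
  have hlt : ∀ {F : ℝ → ℝ≥0∞}, Measurable F → ∫⁻ x, F x ≠ ∞ → ∀ᵐ x, F x < ∞ :=
    fun hF h => ae_lt_top hF h
  have h := lintegral_rpow_mul_le_of_integrable h₁ h₂ h₃ hx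
    (integrable_toReal_of_lintegral_ne_top hF.aemeasurable hFt) (fun _ => ENNReal.toReal_nonneg)
    (integrable_toReal_of_lintegral_ne_top hG.aemeasurable hGt) (fun _ => ENNReal.toReal_nonneg)
    (integrable_toReal_of_lintegral_ne_top hH.aemeasurable hHt) (fun _ => ENNReal.toReal_nonneg)
  rw [integral_toReal hF.aemeasurable (hlt hF hFt), integral_toReal hG.aemeasurable (hlt hG hGt),
    integral_toReal hH.aemeasurable (hlt hH hHt)] at h
  simp only [ENNReal.toReal_rpow, ← ENNReal.toReal_mul] at h
  rw [ENNReal.ofReal_mul hK.le, ENNReal.ofReal_toReal (ENNReal.mul_ne_top (ENNReal.mul_ne_top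
    (ENNReal.rpow_ne_top_of_nonneg hc₁.le hFt) (ENNReal.rpow_ne_top_of_nonneg hc₂.le hGt))
    (ENNReal.rpow_ne_top_of_nonneg hc₃.le hHt))] at h
  refine le_of_eq_of_le (lintegral_congr_ae ?_) h
  have hF' : ∀ᵐ z : ℝ × ℝ, F z.1 < ∞ :=
    (Measure.quasiMeasurePreserving_fst (μ := (volume : Measure ℝ)) (ν := volume)).ae (hlt hF hFt)
  have hG' : ∀ᵐ z : ℝ × ℝ, G z.2 < ∞ :=
    (Measure.quasiMeasurePreserving_snd (μ := (volume : Measure ℝ)) (ν := volume)).ae (hlt hG hGt)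
  have hH' : ∀ᵐ z : ℝ × ℝ, H (z.1 + z.2) < ∞ := quasiMeasurePreserving_add_prod.ae (hlt hH hHt)
  filter_upwards [hF', hG', hH'] with z e1 e2 e3
  rw [ENNReal.ofReal_toReal (ENNReal.mul_ne_top (ENNReal.mul_ne_top
    (ENNReal.rpow_ne_top_of_nonneg hc₁.le e1.ne) (ENNReal.rpow_ne_top_of_nonneg hc₂.le e2.ne))
    (ENNReal.rpow_ne_top_of_nonneg hc₃.le e3.ne))]

/-- The sharp Brascamp-Lieb form of Young's convolution inequality on `Fin n → ℝ`. -/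
theorem lintegral_pi_rpow_mul_le {x₁ x₂ x₃ : ℝ} (h₁ : 0 < x₁) (h₂ : 0 < x₂)
    (h₃ : 0 < x₃) (hx : x₁ + x₂ + x₃ = 1) (n : ℕ) {F G H : (Fin n → ℝ) → ℝ≥0∞}
    (hF : Measurable F) (hG : Measurable G) (hH : Measurable H) :
    ∫⁻ x, ∫⁻ y, F x ^ (1 - x₁) * G y ^ (1 - x₂) * H (x + y) ^ (1 - x₃) ≤
      ENNReal.ofReal (youngConst x₁ x₂ x₃) ^ n *
        ((∫⁻ x, F x) ^ (1 - x₁) * (∫⁻ x, G x) ^ (1 - x₂) * (∫⁻ x, H x) ^ (1 - x₃)) := by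
  induction n with
  | zero =>
    have h : ∀ f : (Fin 0 → ℝ) → ℝ≥0∞, ∫⁻ x, f x = f default := fun f => by
      rw [lintegral_unique, volume_pi, Measure.pi_univ, Finset.univ_eq_empty, Finset.prod_empty,
        mul_one]
      exact congrArg f (Subsingleton.elim _ _)
    simp only [h, pow_zero, one_mul]
    rw [Subsingleton.elim (default + default : Fin 0 → ℝ) default]
  | succ n ih =>
    set e := (MeasurableEquiv.piFinSuccAbove (fun _ : Fin (n + 1) => ℝ) 0).symm with he
    have hmp : MeasurePreserving e (volume.prod volume) volume :=
      (volume_preserving_piFinSuccAbove (fun _ : Fin (n + 1) => ℝ) 0).symm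
    have hadd : ∀ a b : ℝ, ∀ u v : Fin n → ℝ, e (a, u) + e (b, v) = e (a + b, u + v) := by
      intro a b u v
      ext i
      refine Fin.cases ?_ (fun j => ?_) i <;> simp [he, MeasurableEquiv.piFinSuccAbove]
    have hi : ∀ f : (Fin (n + 1) → ℝ) → ℝ≥0∞, Measurable f →
        ∫⁻ x, f x = ∫⁻ a, ∫⁻ u, f (e (a, u)) := fun f hf => by
      rw [← hmp.lintegral_comp hf]
      exact lintegral_prod _ (hf.comp e.measurable).aemeasurable
    have hm : ∀ f : (Fin (n + 1) → ℝ) → ℝ≥0∞, Measurable f →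
        Measurable fun a => ∫⁻ u, f (e (a, u)) := fun f hf =>
      (hf.comp e.measurable).lintegral_prod_right'
    have hs : ∀ a, Measurable fun u => e (a, u) := fun a => e.measurable.comp (by fun_prop)
    set K := ENNReal.ofReal (youngConst x₁ x₂ x₃)
    calc ∫⁻ x, ∫⁻ y, F x ^ (1 - x₁) * G y ^ (1 - x₂) * H (x + y) ^ (1 - x₃)
        = ∫⁻ a, ∫⁻ b, ∫⁻ u, ∫⁻ v, F (e (a, u)) ^ (1 - x₁) * G (e (b, v)) ^ (1 - x₂) *
            H (e (a + b, u + v)) ^ (1 - x₃) := by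
          rw [hi _ (Measurable.lintegral_prod_right (by fun_prop))]
          refine lintegral_congr fun a => ?_
          have : ∀ u, ∫⁻ y, F (e (a, u)) ^ (1 - x₁) * G y ^ (1 - x₂) *
              H (e (a, u) + y) ^ (1 - x₃) = ∫⁻ b, ∫⁻ v, F (e (a, u)) ^ (1 - x₁) *
              G (e (b, v)) ^ (1 - x₂) * H (e (a + b, u + v)) ^ (1 - x₃) := fun u => by
            rw [hi _ (by fun_prop)]
            simp only [hadd]
          simp only [this]
          rw [lintegral_lintegral_swap]
          refine (Measurable.lintegral_prod_right ?_).aemeasurable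
          fun_prop
      -- The induction hypothesis is applied to slices at first coordinates `a`, `b`, `a + b`; the
      -- slice integrals then form a one-dimensional instance.
      _ ≤ ∫⁻ a, ∫⁻ b, K ^ n * ((∫⁻ u, F (e (a, u))) ^ (1 - x₁) *
            (∫⁻ v, G (e (b, v))) ^ (1 - x₂) * (∫⁻ w, H (e (a + b, w))) ^ (1 - x₃)) :=
          lintegral_mono fun a => lintegral_mono fun b =>
            ih (hF.comp (hs a)) (hG.comp (hs b)) (hH.comp (hs (a + b)))
      _ = K ^ n * ∫⁻ a, ∫⁻ b, (∫⁻ u, F (e (a, u))) ^ (1 - x₁) *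
            (∫⁻ v, G (e (b, v))) ^ (1 - x₂) * (∫⁻ w, H (e (a + b, w))) ^ (1 - x₃) := by
          have hK : K ^ n ≠ ∞ := ENNReal.pow_ne_top ENNReal.ofReal_ne_top
          simp only [lintegral_const_mul' _ _ hK]
      _ ≤ K ^ n * (K * ((∫⁻ a, ∫⁻ u, F (e (a, u))) ^ (1 - x₁) *
            (∫⁻ a, ∫⁻ u, G (e (a, u))) ^ (1 - x₂) * (∫⁻ a, ∫⁻ u, H (e (a, u))) ^ (1 - x₃))) := by
          gcongr
          exact lintegral_rpow_mul_le h₁ h₂ h₃ hx (hm F hF) (hm G hG) (hm H hH)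
      _ = _ := by rw [hi F hF, hi G hG, hi H hH, pow_succ]; ring

/-- The sharp Brascamp-Lieb form of Young's convolution inequality on Euclidean space. -/
theorem lintegral_euclidean_rpow_mul_le {x₁ x₂ x₃ : ℝ} (h₁ : 0 < x₁) (h₂ : 0 < x₂)
    (h₃ : 0 < x₃) (hx : x₁ + x₂ + x₃ = 1) (n : ℕ) {F G H : EuclideanSpace ℝ (Fin n) → ℝ≥0∞}
    (hF : Measurable F) (hG : Measurable G) (hH : Measurable H) :
    ∫⁻ x, ∫⁻ y, F x ^ (1 - x₁) * G y ^ (1 - x₂) * H (x + y) ^ (1 - x₃) ≤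
      ENNReal.ofReal (youngConst x₁ x₂ x₃) ^ n *
        ((∫⁻ x, F x) ^ (1 - x₁) * (∫⁻ x, G x) ^ (1 - x₂) * (∫⁻ x, H x) ^ (1 - x₃)) := by
  have hmp := EuclideanSpace.volume_preserving_symm_measurableEquiv_toLp (Fin n)
  set e := (MeasurableEquiv.toLp 2 (Fin n → ℝ))
  have hmp' : MeasurePreserving e volume volume := hmp.symm
  have hadd : ∀ u v : Fin n → ℝ, e u + e v = e (u + v) := fun u v => rfl
  have h := lintegral_pi_rpow_mul_le h₁ h₂ h₃ hx n (hF.comp e.measurable) (hG.comp e.measurable)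
    (hH.comp e.measurable)
  simp only [Function.comp_apply, ← hadd] at h
  have hi : ∀ f : EuclideanSpace ℝ (Fin n) → ℝ≥0∞, ∫⁻ u, f (e u) = ∫⁻ x, f x := fun f =>
    hmp'.lintegral_comp_emb e.measurableEmbedding f
  simp only [hi] at h
  refine le_of_eq_of_le ?_ h
  rw [← hi fun x => ∫⁻ y, F x ^ (1 - x₁) * G y ^ (1 - x₂) * H (x + y) ^ (1 - x₃)]
  exact lintegral_congr fun u =>
    (hi fun y => F (e u) ^ (1 - x₁) * G y ^ (1 - x₂) * H (e u + y) ^ (1 - x₃)).symm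

/-! ### Power series of the entropy deficit. -/

/-- For `u < 1`, partial fractions reduce this to the series of `-log (1 - u)`. The endpoint `u =
1`, needed for the binary entropy, telescopes instead. -/
theorem hasSum_one_sub_mul_log_one_sub {u : ℝ} (h0 : 0 ≤ u) (h1 : u ≤ 1) :
    HasSum (fun k : ℕ => u ^ (k + 2) / ((k + 1) * (k + 2))) ((1 - u) * Real.log (1 - u) + u) := by
  rcases h1.eq_or_lt with rfl | h1
  · rw [hasSum_iff_tendsto_nat_of_nonneg (fun k => by positivity)]
    have h : ∀ n : ℕ, ∑ k ∈ Finset.range n, (1 : ℝ) ^ (k + 2) / ((k + 1) * (k + 2)) =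
        1 - 1 / ((n : ℝ) + 1) := fun n => by
      induction n with
      | zero => simp
      | succ n ih =>
        rw [Finset.sum_range_succ, ih]
        push_cast
        field_simp
        ring
    simp only [h]
    simpa using (tendsto_one_div_add_atTop_nhds_zero_nat (𝕜 := ℝ)).const_sub 1
  · have h := Real.hasSum_pow_div_log_of_abs_lt_one (x := u) (by rwa [abs_of_nonneg h0])
    have hA := h.mul_left u
    have hB := (hasSum_nat_add_iff' 1).2 h
    convert! hA.sub hB using 1
    · ext k
      push_cast
      field_simp
      ring
    · simp
      ring

/-- The deficit `D(t, l) = ∑ₖ tᵏ (1 - lᵏ - (1 - l)ᵏ) / (k (k - 1))`, in closed form. At `t = 1` it is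
the binary entropy of `l`. -/
noncomputable def entropyDeficit (t l : ℝ) : ℝ :=
  (1 - t) * Real.log (1 - t) - (1 - l * t) * Real.log (1 - l * t) -
    (1 - (1 - l) * t) * Real.log (1 - (1 - l) * t)

/-- The previous series at `t`, `l t`, `(1 - l) t`; the linear terms cancel because `t = l t + (1 -
l) t`. -/
theorem hasSum_entropyDeficit {t l : ℝ} (ht0 : 0 ≤ t) (ht1 : t ≤ 1) (hl0 : 0 ≤ l) (hl1 : l ≤ 1) :
    HasSum (fun k : ℕ => t ^ (k + 2) *
      ((1 - l ^ (k + 2) - (1 - l) ^ (k + 2)) / ((k + 1) * (k + 2)))) (entropyDeficit t l) := by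
  have hl' : 0 ≤ 1 - l := by linarith
  convert! ((hasSum_one_sub_mul_log_one_sub ht0 ht1).sub
    (hasSum_one_sub_mul_log_one_sub (mul_nonneg hl0 ht0) (mul_le_one₀ hl1 ht0 ht1))).sub
    (hasSum_one_sub_mul_log_one_sub (mul_nonneg hl' ht0) (mul_le_one₀ (by linarith) ht0 ht1)) using 1
  · ext k
    rw [mul_pow, mul_pow]
    ring
  · unfold entropyDeficit
    ring

theorem entropyDeficit_one_half : entropyDeficit 1 (1 / 2) = Real.log 2 := by
  unfold entropyDeficit
  rw [show (1 : ℝ) - 1 / 2 * 1 = 2⁻¹ by norm_num, show (1 : ℝ) - (1 - 1 / 2) * 1 = 2⁻¹ by norm_num,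
    Real.log_inv]
  ring

/-- `1 - lᵏ - (1 - l)ᵏ` is at most `2ᵏ - 2` times its forward difference. -/
theorem one_sub_pow_sub_pow_le {l : ℝ} (hl0 : 0 ≤ l) (hl1 : l ≤ 1) (k : ℕ) :
    1 - l ^ (k + 1) - (1 - l) ^ (k + 1) ≤
      (2 ^ (k + 1) - 2) * (l ^ (k + 1) * (1 - l) + (1 - l) ^ (k + 1) * l) := by
  have hl' : 0 ≤ 1 - l := by linarith
  induction k with
  | zero => simp
  | succ k ih =>
    set m := 1 - l with hm
    -- Each forward difference is at least half the preceding one, since `l - m` and `l ^ k - m ^ k`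
    -- have the same sign.
    have hs : l ^ (k + 1) * m + m ^ (k + 1) * l ≤ 2 * (l ^ (k + 2) * m + m ^ (k + 2) * l) := by
      have h : 0 ≤ l * m * ((l - m) * (l ^ k - m ^ k)) := by
        refine mul_nonneg (by positivity) ?_
        rcases le_total l m with h | h
        · exact mul_nonneg_of_nonpos_of_nonpos (by linarith)
            (by linarith [pow_le_pow_left₀ hl0 h k])
        · exact mul_nonneg (by linarith) (by linarith [pow_le_pow_left₀ hl' h k])
      have e : 2 * (l ^ (k + 2) * m + m ^ (k + 2) * l) - (l ^ (k + 1) * m + m ^ (k + 1) * l) =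
          l * m * ((l - m) * (l ^ k - m ^ k)) := by
        rw [hm]; ring
      linarith
    have h2 : (1 : ℝ) ≤ 2 ^ (k + 1) := one_le_pow₀ (by norm_num)
    calc 1 - l ^ (k + 2) - m ^ (k + 2)
        = (1 - l ^ (k + 1) - m ^ (k + 1)) + (l ^ (k + 1) * m + m ^ (k + 1) * l) := by
          rw [hm]; ring
      _ ≤ (2 ^ (k + 1) - 1) * (l ^ (k + 1) * m + m ^ (k + 1) * l) := by linarith
      _ ≤ (2 ^ (k + 1) - 1) * (2 * (l ^ (k + 2) * m + m ^ (k + 2) * l)) := by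
          gcongr
      _ = _ := by ring

/-- The ratio of `1 - lᵏ - (1 - l)ᵏ` to its value at `l = 1 / 2` is nondecreasing in `k`. -/
theorem monotone_one_sub_pow_sub_pow_div {l : ℝ} (hl0 : 0 ≤ l) (hl1 : l ≤ 1) :
    Monotone fun k : ℕ => (1 - l ^ (k + 2) - (1 - l) ^ (k + 2)) / (1 - (1 / 2) ^ (k + 1)) := by
  refine monotone_nat_of_le_succ fun k => ?_
  have hpos : ∀ k : ℕ, (0 : ℝ) < 1 - (1 / 2) ^ (k + 1) := fun k =>
    sub_pos.2 (pow_lt_one₀ (by norm_num) (by norm_num) k.succ_ne_zero)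
  rw [div_le_div_iff₀ (hpos _) (hpos _)]
  have h := one_sub_pow_sub_pow_le hl0 hl1 (k + 1)
  have h2 : (0 : ℝ) < (1 / 2) ^ (k + 2) := by positivity
  have h3 : (1 / 2 : ℝ) ^ (k + 2) * 2 ^ (k + 2) = 1 := by
    rw [← mul_pow]; norm_num
  have h4 := mul_le_mul_of_nonneg_left h h2.le
  have e : (1 - l ^ (k + 1 + 2) - (1 - l) ^ (k + 1 + 2)) = (1 - l ^ (k + 2) - (1 - l) ^ (k + 2)) +
    (l ^ (k + 2) * (1 - l) + (1 - l) ^ (k + 2) * l) := by ring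
  rw [e]
  have e5 : (1 / 2 : ℝ) ^ (k + 1) = 2 * (1 / 2) ^ (k + 2) := by ring
  rw [e5]
  have e6 : (1 / 2 : ℝ) ^ (k + 2) * ((2 ^ (k + 2) - 2) *
      (l ^ (k + 2) * (1 - l) + (1 - l) ^ (k + 2) * l)) = (1 - 2 * (1 / 2) ^ (k + 2)) *
      (l ^ (k + 2) * (1 - l) + (1 - l) ^ (k + 2) * l) := by
    linear_combination (l ^ (k + 2) * (1 - l) + (1 - l) ^ (k + 2) * l) * h3
  rw [show k + 1 + 1 = k + 2 from rfl] at *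
  linarith

theorem entropyDeficit_pos {t : ℝ} (ht0 : 0 < t) (ht1 : t ≤ 1) : 0 < entropyDeficit t (1 / 2) := by
  have h := hasSum_entropyDeficit ht0.le ht1 (l := 1 / 2) (by norm_num) (by norm_num)
  have hnn : ∀ k : ℕ, (0 : ℝ) ≤ (1 - (1 / 2) ^ (k + 2) - (1 - 1 / 2) ^ (k + 2)) := fun k => by
    have : (1 / 2 : ℝ) ^ k ≤ 1 := pow_le_one₀ (by norm_num) (by norm_num)
    rw [show (1 : ℝ) - 1 / 2 = 1 / 2 by norm_num, pow_add]
    linarith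
  refine lt_of_lt_of_le ?_ (h.tsum_eq ▸ h.summable.le_tsum 0 fun k _ => ?_)
  · norm_num
    positivity
  · exact mul_nonneg (by positivity) (div_nonneg (hnn k) (by positivity))

/-- Among all `l`, the quotient `D(t, l) / D(1, l)` is largest at `l = 1 / 2`. -/
theorem entropyDeficit_mul_le {t l : ℝ} (ht0 : 0 < t) (ht1 : t < 1) (hl0 : 0 ≤ l) (hl1 : l ≤ 1) :
    entropyDeficit t l * Real.log 2 ≤ entropyDeficit t (1 / 2) * entropyDeficit 1 l := by
  have hlog : 0 < Real.log 2 := Real.log_pos (by norm_num)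
  -- With this `κ` the sum of `(t ^ (k + 2) - κ) * a k` is zero. Its terms change sign once, from
  -- positive to nonpositive, so weighting them by the nondecreasing `r` makes the sum at most `r k₀
  -- * 0`, where `k₀` is the first index past the change.
  set κ := entropyDeficit t (1 / 2) / Real.log 2 with hκ
  have hκpos : 0 < κ := div_pos (entropyDeficit_pos ht0 ht1.le) hlog
  set r : ℕ → ℝ := fun k => (1 - l ^ (k + 2) - (1 - l) ^ (k + 2)) / (1 - (1 / 2) ^ (k + 1)) with hr
  have hrm : Monotone r := monotone_one_sub_pow_sub_pow_div hl0 hl1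
  set a : ℕ → ℝ := fun k => (1 - (1 / 2) ^ (k + 1)) / ((k + 1) * (k + 2)) with ha
  have hpos : ∀ k : ℕ, (0 : ℝ) < 1 - (1 / 2) ^ (k + 1) := fun k =>
    sub_pos.2 (pow_lt_one₀ (by norm_num) (by norm_num) k.succ_ne_zero)
  have hapos : ∀ k, 0 < a k := fun k => div_pos (hpos k) (by positivity)
  have hhalf : ∀ s : ℝ, 0 ≤ s → s ≤ 1 → HasSum (fun k => s ^ (k + 2) * a k)
      (entropyDeficit s (1 / 2)) := fun s h0 h1 => by
    convert! hasSum_entropyDeficit h0 h1 (l := 1 / 2) (by norm_num) (by norm_num) using 1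
    ext k
    simp only [ha]
    congr 2
    rw [show (1 : ℝ) - 1 / 2 = 1 / 2 by norm_num]
    ring
  have hgen : ∀ s : ℝ, 0 ≤ s → s ≤ 1 → HasSum (fun k => s ^ (k + 2) * (a k * r k))
      (entropyDeficit s l) := fun s h0 h1 => by
    convert! hasSum_entropyDeficit h0 h1 hl0 hl1 using 1
    ext k
    simp only [ha, hr]
    have := (hpos k).ne'
    field_simp
  have hsum0 : HasSum (fun k => (t ^ (k + 2) - κ) * a k) 0 := by
    convert! (hhalf t ht0.le ht1.le).sub ((hhalf 1 zero_le_one le_rfl).mul_left κ) using 1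
    · ext k; simp; ring
    · rw [entropyDeficit_one_half, hκ]
      field_simp
      ring
  have hsum1 : HasSum (fun k => (t ^ (k + 2) - κ) * (a k * r k))
      (entropyDeficit t l - κ * entropyDeficit 1 l) := by
    convert! (hgen t ht0.le ht1.le).sub ((hgen 1 zero_le_one le_rfl).mul_left κ) using 1
    ext k; simp; ring
  have hex : ∃ k : ℕ, t ^ (k + 2) ≤ κ := by
    obtain ⟨k, hk⟩ := exists_pow_lt_of_lt_one hκpos ht1
    exact ⟨k, (pow_le_pow_of_le_one ht0.le ht1.le (by omega)).trans hk.le⟩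
  classical
  set k₀ := Nat.find hex
  have hle := hasSum_le (fun k => ?_) hsum1 (hsum0.mul_right (r k₀))
  · rw [zero_mul, hκ] at hle
    have := mul_le_mul_of_nonneg_right hle hlog.le
    rw [zero_mul, sub_mul] at this
    have e : entropyDeficit t (1 / 2) / Real.log 2 * entropyDeficit 1 l * Real.log 2 =
      entropyDeficit t (1 / 2) * entropyDeficit 1 l := by field_simp
    linarith
  · rw [← mul_assoc]
    rcases le_or_gt k₀ k with hk | hk
    · have h1 : t ^ (k + 2) ≤ κ :=
        (pow_le_pow_of_le_one ht0.le ht1.le (by omega)).trans (Nat.find_spec hex)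
      exact mul_le_mul_of_nonpos_left (hrm hk)
        (mul_nonpos_of_nonpos_of_nonneg (by linarith) (hapos k).le)
    · have h1 : κ < t ^ (k + 2) := not_le.1 (Nat.find_min hex hk)
      exact mul_le_mul_of_nonneg_left (hrm hk.le) (mul_nonneg (by linarith) (hapos k).le)

/-- This is `α < (p + 1) / 2` written in `t = (p - 1) / p`. The difference of the sides is a power
series vanishing at `t = 1`, with coefficients negative for `k < 3` and nonnegative afterwards;
comparing it termwise with `t ^ 5` times its value at 1 gives the sign. -/
theorem entropyDeficit_half_lt {t : ℝ} (ht0 : 0 < t) (ht1 : t < 1) :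
    entropyDeficit t (1 / 2) < Real.log 2 * (t ^ 2 / (2 - t)) := by
  have hlog1 := Real.log_two_gt_d9
  have hlog2 := Real.log_two_lt_d9
  set a : ℕ → ℝ := fun k => (1 - (1 / 2) ^ (k + 1)) / ((k + 1) * (k + 2)) -
    Real.log 2 * (1 / 2) ^ (k + 1) with ha
  have hsum : ∀ s : ℝ, 0 < s → s ≤ 1 → HasSum (fun k => s ^ (k + 2) * a k)
      (entropyDeficit s (1 / 2) - Real.log 2 * (s ^ 2 / (2 - s))) := fun s h0 h1 => by
    have hg := (hasSum_geometric_of_lt_one (r := s / 2) (by positivity)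
      (by linarith)).mul_left (Real.log 2 * (s ^ 2 / 2))
    convert! (hasSum_entropyDeficit h0.le h1 (l := 1 / 2) (by norm_num) (by norm_num)).sub hg using 1
    · ext k
      simp only [ha]
      rw [show (1 : ℝ) - 1 / 2 = 1 / 2 by norm_num, div_pow s]
      simp only [one_div, inv_pow]
      field_simp
      ring
    · have h2 : (2 : ℝ) - s ≠ 0 := by linarith
      have h3 : 1 - s / 2 ≠ 0 := by
        intro h; apply h2; linarith
      rw [show 1 - s / 2 = (2 - s) / 2 by ring]
      field_simp
  have hneg : ∀ k < 3, a k < 0 := by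
    intro k hk
    interval_cases k <;> simp only [ha] <;> norm_num <;> linarith
  have hpos : ∀ k, 3 ≤ k → 0 ≤ a k := by
    intro k hk
    -- `7 / 10` is a rational upper bound for `log 2`.
    have h : (7 / 10 : ℝ) * ((k + 1) * (k + 2)) ≤ 2 ^ (k + 1) - 1 := by
      induction k, hk using Nat.le_induction with
      | base => norm_num
      | succ k hk ih =>
        have hk' : (3 : ℝ) ≤ k := by exact_mod_cast hk
        rw [pow_succ]
        push_cast
        nlinarith
    have hp : (0 : ℝ) < (k + 1) * (k + 2) := by positivity
    have h2 : (0 : ℝ) < 2 ^ (k + 1) := by positivity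
    simp only [ha]
    rw [sub_nonneg, le_div_iff₀ hp, div_pow, one_pow, show (1 : ℝ) - 1 / 2 ^ (k + 1) =
      (2 ^ (k + 1) - 1) / 2 ^ (k + 1) by field_simp, le_div_iff₀ h2]
    calc Real.log 2 * (1 / 2 ^ (k + 1)) * ((k + 1) * (k + 2)) * 2 ^ (k + 1)
        = Real.log 2 * ((k + 1) * (k + 2)) := by field_simp
      _ ≤ 7 / 10 * ((k + 1) * (k + 2)) := by gcongr; linarith
      _ ≤ _ := h
  have h1 := hsum 1 one_pos le_rfl
  rw [entropyDeficit_one_half] at h1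
  have hpow : ∀ {i j : ℕ}, i ≤ j → t ^ j ≤ t ^ i := fun h =>
    pow_le_pow_of_le_one ht0.le ht1.le h
  have hlt := hasSum_lt (i := 0) (fun k => ?_) ?_ (hsum t ht0 ht1.le) (h1.mul_left (t ^ 5))
  · norm_num at hlt
    linarith
  · simp only [one_pow, one_mul]
    rcases lt_or_ge k 3 with hk | hk
    · exact mul_le_mul_of_nonpos_right (hpow (by omega)) (hneg k hk).le
    · exact mul_le_mul_of_nonneg_right (hpow (by omega)) (hpos k hk)
  · simp only [one_pow, one_mul]
    exact mul_lt_mul_of_neg_right (pow_lt_pow_right_of_lt_one₀ ht0 ht1 (by norm_num))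
      (hneg 0 (by norm_num))

/-! ### The exponent and the sharp constant in terms of the deficit. -/

theorem inv_renyiExponent {p : ℝ} (hp : 1 < p) :
    (renyiExponent p)⁻¹ =
      1 - entropyDeficit ((p - 1) / p) (1 / 2) / ((p - 1) / p * Real.log 2) := by
  have hp0 : p ≠ 0 := by linarith
  have hp1 : p - 1 ≠ 0 := by linarith
  have hlog : Real.log 2 ≠ 0 := (Real.log_pos (by norm_num)).ne'
  unfold renyiExponent entropyDeficit
  rw [inv_inv, show 1 - (p - 1) / p = p⁻¹ by field_simp; ring,
    show 1 - 1 / 2 * ((p - 1) / p) = (p + 1) / (2 * p) by field_simp; ring,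
    show 1 - (1 - 1 / 2) * ((p - 1) / p) = (p + 1) / (2 * p) by field_simp; ring, Real.log_inv]
  field_simp
  ring

theorem renyiExponent_pos_and_lt {p : ℝ} (hp : 1 < p) :
    0 < renyiExponent p ∧ renyiExponent p < (p + 1) / 2 := by
  have hp0 : 0 < p := by linarith
  have hp1 : 0 < p - 1 := by linarith
  have hlog : 0 < Real.log 2 := Real.log_pos (by norm_num)
  have ht0 : 0 < (p - 1) / p := by positivity
  have ht1 : (p - 1) / p < 1 := by rw [div_lt_one hp0]; linarith
  have h := entropyDeficit_half_lt ht0 ht1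
  -- This one bound yields both positivity and the upper bound.
  have h2 : 2 / (p + 1) < (renyiExponent p)⁻¹ := by
    rw [inv_renyiExponent hp, lt_sub_comm, div_lt_iff₀ (by positivity)]
    refine h.trans_eq ?_
    have : (2 : ℝ) - (p - 1) / p = (p + 1) / p := by field_simp; ring
    rw [this]
    field_simp
    ring
  have h3 : 0 < renyiExponent p := inv_pos.1 (lt_trans (by positivity) h2)
  refine ⟨h3, ?_⟩
  have := inv_strictAnti₀ (by positivity) h2
  rwa [inv_inv, inv_div] at this

/-- As `x₁ + x₂ = t = 1 - x₃`, the `t log t` terms cancel, leaving `2 log K = D(t, l) - t D(1, l)`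
for the constant `K`. -/
theorem log_youngConst {p l : ℝ} (hp : 1 < p) (hl0 : 0 < l) (hl1 : l < 1) :
    -(2 * p / (p - 1)) *
        Real.log (youngConst (l * ((p - 1) / p)) ((1 - l) * ((p - 1) / p)) (1 / p)) =
      entropyDeficit 1 l - entropyDeficit ((p - 1) / p) l / ((p - 1) / p) := by
  have hp0 : 0 < p := by linarith
  have hp1 : 0 < p - 1 := by linarith
  set t := (p - 1) / p with ht
  have ht0 : 0 < t := by positivity
  have ht1 : t < 1 := by rw [ht, div_lt_one hp0]; linarith
  have hl' : 0 < 1 - l := by linarith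
  have e1 : 1 / p = 1 - t := by rw [ht]; field_simp; ring
  have e2 : 2 * p / (p - 1) = 2 / t := by rw [ht]; field_simp
  have ht1' : 0 < 1 - t := by linarith
  have hx₁ : 0 < l * t := by positivity
  have hx₂ : 0 < (1 - l) * t := by positivity
  have hc₁ : 0 < 1 - l * t := by nlinarith
  have hc₂ : 0 < 1 - (1 - l) * t := by nlinarith
  rw [e1, e2]
  unfold youngConst entropyDeficit
  rw [sub_sub_cancel, Real.log_sqrt (by positivity), Real.log_div (by positivity) (by positivity),
    Real.log_mul (by positivity) (by positivity), Real.log_mul (by positivity) (by positivity),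
    Real.log_mul (by positivity) (by positivity), Real.log_mul (by positivity) (by positivity),
    Real.log_rpow hx₁, Real.log_rpow hx₂, Real.log_rpow ht1', Real.log_rpow hc₁, Real.log_rpow hc₂,
    Real.log_rpow ht0, Real.log_mul hl0.ne' ht0.ne', Real.log_mul hl'.ne' ht0.ne', mul_one, mul_one,
    sub_sub_cancel, sub_self, zero_mul]
  field_simp
  ring

/-- The entropy gain in Young's inequality, scaled by the exponent, dominates the binary entropy. -/
theorem binEntropy_le_renyiExponent_mul {p l : ℝ} (hp : 1 < p) (hl0 : 0 < l) (hl1 : l < 1) :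
    -(l * Real.log l + (1 - l) * Real.log (1 - l)) ≤ renyiExponent p * (-(2 * p / (p - 1)) *
        Real.log (youngConst (l * ((p - 1) / p)) ((1 - l) * ((p - 1) / p)) (1 / p))) := by
  have hp0 : 0 < p := by linarith
  have hp1 : 0 < p - 1 := by linarith
  have hlog : 0 < Real.log 2 := Real.log_pos (by norm_num)
  have ht0 : 0 < (p - 1) / p := by positivity
  have ht1 : (p - 1) / p < 1 := by rw [div_lt_one hp0]; linarith
  have hα := (renyiExponent_pos_and_lt hp).1
  have h := entropyDeficit_mul_le ht0 ht1 hl0.le hl1.le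
  have hinv := inv_renyiExponent hp
  rw [log_youngConst hp hl0 hl1]
  set t := (p - 1) / p
  have hH : -(l * Real.log l + (1 - l) * Real.log (1 - l)) = entropyDeficit 1 l := by
    unfold entropyDeficit
    rw [mul_one, mul_one, sub_sub_cancel, sub_self]
    ring
  rw [hH, ← inv_mul_le_iff₀ hα, hinv, sub_mul, one_mul]
  refine sub_le_sub_left ?_ _
  rw [div_mul_eq_mul_div, div_le_div_iff₀ ht0 (by positivity)]
  nlinarith

/-! ### Densities of sums and the linearised inequality. -/

/-- Interpolation of `Lᵖ` norms of a probability density between `1` and `p`. -/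
theorem lintegral_rpow_rpow_le {α : Type*} [MeasurableSpace α] {μ : Measure α} {f : α → ℝ≥0∞}
    (hf : AEMeasurable f μ) (hf1 : ∫⁻ x, f x ∂μ = 1) {p x : ℝ} (hp : 1 < p) (hx0 : 0 < x)
    (hxp : x < (p - 1) / p) :
    (∫⁻ a, f a ^ (1 / (1 - x)) ∂μ) ^ (1 - x) ≤ (∫⁻ a, f a ^ p ∂μ) ^ (x / (p - 1)) := by
  have hp0 : 0 < p := by linarith
  have hp1 : 0 < p - 1 := by linarith
  have hxp' : x * p < p - 1 := (lt_div_iff₀ hp0).1 hxp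
  have hc : 0 < 1 - x := by nlinarith
  have hcp : 0 < (1 - x) * (p - 1) := by positivity
  have hb : 0 ≤ x / ((1 - x) * (p - 1)) := by positivity
  have ha : 0 ≤ (p - 1 - x * p) / ((1 - x) * (p - 1)) := div_nonneg (by linarith) hcp.le
  -- The Hölder weights `a`, `b` solve `a + b = 1` and `a + p b = 1 / (1 - x)`.
  have hab : (p - 1 - x * p) / ((1 - x) * (p - 1)) + x / ((1 - x) * (p - 1)) = 1 := by
    field_simp
    ring
  have h := ENNReal.lintegral_mul_norm_pow_le hf (hf.pow_const p) ha hb hab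
  rw [hf1, ENNReal.one_rpow, one_mul] at h
  have e : ∀ a, f a ^ ((p - 1 - x * p) / ((1 - x) * (p - 1))) *
      (f a ^ p) ^ (x / ((1 - x) * (p - 1))) = f a ^ (1 / (1 - x)) := fun a => by
    rw [← ENNReal.rpow_mul, ← ENNReal.rpow_add_of_nonneg _ _ ha (by positivity)]
    congr 1
    field_simp
    ring
  simp only [e] at h
  calc _ ≤ ((∫⁻ a, f a ^ p ∂μ) ^ (x / ((1 - x) * (p - 1)))) ^ (1 - x) :=
        ENNReal.rpow_le_rpow h hc.le
    _ = _ := by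
        rw [← ENNReal.rpow_mul]
        congr 1
        field_simp

variable {Ω : Type*} [MeasurableSpace Ω] {n : ℕ} {p : ℝ} {P : Measure Ω}
  {X Y : Ω → EuclideanSpace ℝ (Fin n)}

theorem lintegral_pdf_eq_one [IsProbabilityMeasure P] [HasPDF X P volume] :
    ∫⁻ x, pdf X P volume x = 1 := by
  rw [pdf.lintegral_eq_measure_univ, measure_univ]

/-- Both sides are the expectation of `φ (X + Y)`; independence makes the joint law a product. -/
theorem lintegral_pdf_add_mul [IsFiniteMeasure P] (hX : Measurable X) (hY : Measurable Y)
    (hXY : IndepFun X Y P) [HasPDF X P volume] [HasPDF Y P volume] [HasPDF (X + Y) P volume]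
    {φ : EuclideanSpace ℝ (Fin n) → ℝ≥0∞} (hφ : Measurable φ) :
    ∫⁻ z, pdf (X + Y) P volume z * φ z =
      ∫⁻ x, ∫⁻ y, pdf X P volume x * pdf Y P volume y * φ (x + y) := by
  have hinner : ∀ x, ∫⁻ y, pdf Y P volume y * φ (x + y) = ∫⁻ y, φ (x + y) ∂(P.map Y) := fun x => by
    rw [pdf.lintegral_pdf_mul (X := Y) (f := fun y => φ (x + y)) (by fun_prop),
      lintegral_map (by fun_prop) hY]
  have hm : Measurable fun x => ∫⁻ y, φ (x + y) ∂(P.map Y) :=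
    Measurable.lintegral_prod_right (by fun_prop)
  have hpY := measurable_pdf Y P volume
  calc ∫⁻ z, pdf (X + Y) P volume z * φ z = ∫⁻ ω, φ (X ω + Y ω) ∂P :=
        pdf.lintegral_pdf_mul hφ.aemeasurable
    _ = ∫⁻ z, φ (z.1 + z.2) ∂(P.map fun ω => (X ω, Y ω)) := by
        rw [lintegral_map (by fun_prop) (hX.prodMk hY)]
    _ = ∫⁻ x, ∫⁻ y, φ (x + y) ∂(P.map Y) ∂(P.map X) := by
        rw [(indepFun_iff_map_prod_eq_prod_map_map hX.aemeasurable hY.aemeasurable).1 hXY,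
          lintegral_prod _ (by fun_prop)]
    _ = ∫⁻ x, pdf X P volume x * ∫⁻ y, φ (x + y) ∂(P.map Y) := by
        rw [lintegral_map hm hX, pdf.lintegral_pdf_mul hm.aemeasurable]
    _ = _ := by
        refine lintegral_congr fun x => ?_
        rw [← hinner, ← lintegral_const_mul _ (by fun_prop)]
        simp only [mul_assoc]

/-- Young's inequality for the density of a sum of independent random vectors. -/
theorem lintegral_pdf_add_rpow_le [IsProbabilityMeasure P] (hX : Measurable X) (hY : Measurable Y)
    (hXY : IndepFun X Y P) [HasPDF X P volume] [HasPDF Y P volume] [HasPDF (X + Y) P volume]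
    (hp : 1 < p) {l : ℝ} (hl0 : 0 < l) (hl1 : l < 1) :
    ∫⁻ z, pdf (X + Y) P volume z ^ p ≤
      ENNReal.ofReal (youngConst (l * ((p - 1) / p)) ((1 - l) * ((p - 1) / p)) (1 / p)) ^ n *
        ((∫⁻ z, pdf X P volume z ^ p) ^ (l / p) * (∫⁻ z, pdf Y P volume z ^ p) ^ ((1 - l) / p) *
          (∫⁻ z, pdf (X + Y) P volume z ^ p) ^ (1 - 1 / p)) := by
  have hp0 : 0 < p := by linarith
  have hp1 : 0 < p - 1 := by linarith
  have hl' : 0 < 1 - l := by linarith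
  set t := (p - 1) / p with ht
  have ht0 : 0 < t := by positivity
  have ht1 : t < 1 := by rw [ht, div_lt_one hp0]; linarith
  have hc₁ : 0 < 1 - l * t := by nlinarith
  have hc₂ : 0 < 1 - (1 - l) * t := by nlinarith
  have hc₃ : 0 < 1 - 1 / p := by rw [sub_pos, div_lt_one hp0]; exact hp
  have hmX := measurable_pdf X P volume
  have hmY := measurable_pdf Y P volume
  have hmS := measurable_pdf (X + Y) P volume
  have hroot : ∀ (a : ℝ≥0∞) (c : ℝ), 0 < c → (a ^ (1 / c)) ^ c = a := fun a c hc => by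
    rw [← ENNReal.rpow_mul, one_div_mul_cancel hc.ne', ENNReal.rpow_one]
  calc ∫⁻ z, pdf (X + Y) P volume z ^ p
      = ∫⁻ z, pdf (X + Y) P volume z * pdf (X + Y) P volume z ^ (p - 1) := by
        refine lintegral_congr fun z => ?_
        conv_lhs => rw [show p = 1 + (p - 1) by ring,
          ENNReal.rpow_add_of_nonneg _ _ zero_le_one hp1.le, ENNReal.rpow_one]
    _ = ∫⁻ x, ∫⁻ y, pdf X P volume x * pdf Y P volume y * pdf (X + Y) P volume (x + y) ^ (p - 1) :=
        lintegral_pdf_add_mul hX hY hXY (hmS.pow_const _)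
    _ = ∫⁻ x, ∫⁻ y, (pdf X P volume x ^ (1 / (1 - l * t))) ^ (1 - l * t) *
          (pdf Y P volume y ^ (1 / (1 - (1 - l) * t))) ^ (1 - (1 - l) * t) *
          (pdf (X + Y) P volume (x + y) ^ p) ^ (1 - 1 / p) := by
        refine lintegral_congr fun x => lintegral_congr fun y => ?_
        rw [hroot _ _ hc₁, hroot _ _ hc₂, ← ENNReal.rpow_mul, mul_sub, mul_one,
          mul_one_div_cancel hp0.ne']
    _ ≤ _ := lintegral_euclidean_rpow_mul_le (by positivity) (by positivity) (by positivity)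
          (by rw [ht]; field_simp; ring) n (hmX.pow_const _) (hmY.pow_const _) (hmS.pow_const p)
    _ ≤ _ := by
        have e1 := lintegral_rpow_rpow_le hmX.aemeasurable lintegral_pdf_eq_one hp
          (x := l * t) (by positivity) (by rw [← ht]; nlinarith)
        have e2 := lintegral_rpow_rpow_le hmY.aemeasurable lintegral_pdf_eq_one hp
          (x := (1 - l) * t) (by positivity) (by rw [← ht]; nlinarith)
        rw [show l * t / (p - 1) = l / p by rw [ht]; field_simp] at e1
        rw [show (1 - l) * t / (p - 1) = (1 - l) / p by rw [ht]; field_simp] at e2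
        gcongr

theorem HasFiniteRenyiEntropy.lintegral_ne (hp : 1 < p) (h : HasFiniteRenyiEntropy p P X) :
    ∫⁻ x, pdf X P volume x ^ p ≠ 0 ∧ ∫⁻ x, pdf X P volume x ^ p ≠ ∞ := by
  obtain ⟨_, h1, h2⟩ := h
  have hneg : 1 / (1 - p) < 0 := one_div_neg.2 (by linarith)
  unfold renyiEntropy at h1 h2
  constructor
  · intro h0
    rw [h0, ENNReal.log_zero, EReal.coe_mul_bot_of_neg hneg] at h2
    exact h2 rfl
  · intro h0
    rw [h0, ENNReal.log_top, EReal.coe_mul_top_of_neg hneg] at h1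
    exact h1 rfl

/-- If the integral is `0` or `∞`, both sides are `0` by the default values of `toReal` and
`Real.log`. -/
theorem toReal_renyiEntropy :
    (renyiEntropy p P X).toReal =
      1 / (1 - p) * Real.log (∫⁻ x, pdf X P volume x ^ p).toReal := by
  unfold renyiEntropy
  rw [EReal.toReal_mul, EReal.toReal_coe]
  congr 1
  by_cases h0 : ∫⁻ x, pdf X P volume x ^ p = 0
  · simp [h0]
  by_cases h1 : ∫⁻ x, pdf X P volume x ^ p = ∞
  · simp [h1]
  rw [ENNReal.log_pos_real h0 h1, EReal.toReal_coe]

/-- The linearised Rényi entropy power inequality. -/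
theorem renyiEntropy_add_ge [IsProbabilityMeasure P] (hX : Measurable X) (hY : Measurable Y)
    (hXY : IndepFun X Y P) (hp : 1 < p) (hfX : HasFiniteRenyiEntropy p P X)
    (hfY : HasFiniteRenyiEntropy p P Y) (hfXY : HasFiniteRenyiEntropy p P (X + Y))
    {l : ℝ} (hl0 : 0 < l) (hl1 : l < 1) :
    l * (renyiEntropy p P X).toReal + (1 - l) * (renyiEntropy p P Y).toReal - p * n / (p - 1) *
        Real.log (youngConst (l * ((p - 1) / p)) ((1 - l) * ((p - 1) / p)) (1 / p)) ≤
      (renyiEntropy p P (X + Y)).toReal := by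
  have hp0 : 0 < p := by linarith
  have hp1 : 0 < p - 1 := by linarith
  have hl' : 0 < 1 - l := by linarith
  have := hfX.1
  have := hfY.1
  have := hfXY.1
  obtain ⟨hX0, hX1⟩ := hfX.lintegral_ne hp
  obtain ⟨hY0, hY1⟩ := hfY.lintegral_ne hp
  obtain ⟨hS0, hS1⟩ := hfXY.lintegral_ne hp
  have h := lintegral_pdf_add_rpow_le hX hY hXY hp hl0 hl1
  have hK : 0 < youngConst (l * ((p - 1) / p)) ((1 - l) * ((p - 1) / p)) (1 / p) := by
    have ht0 : 0 < (p - 1) / p := by positivity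
    have ht1 : (p - 1) / p < 1 := by rw [div_lt_one hp0]; linarith
    have hc₁ : 0 < 1 - l * ((p - 1) / p) := by nlinarith
    have hc₂ : 0 < 1 - (1 - l) * ((p - 1) / p) := by nlinarith
    have hc₃ : 0 < 1 - 1 / p := by rw [sub_pos, div_lt_one hp0]; exact hp
    unfold youngConst
    positivity
  rw [toReal_renyiEntropy, toReal_renyiEntropy, toReal_renyiEntropy]
  set K := youngConst (l * ((p - 1) / p)) ((1 - l) * ((p - 1) / p)) (1 / p)
  set A := ∫⁻ z, pdf X P volume z ^ p
  set B := ∫⁻ z, pdf Y P volume z ^ p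
  set C := ∫⁻ z, pdf (X + Y) P volume z ^ p
  have hA := ENNReal.toReal_pos hX0 hX1
  have hB := ENNReal.toReal_pos hY0 hY1
  have hC := ENNReal.toReal_pos hS0 hS1
  have hc₃ : 0 ≤ 1 - 1 / p := by rw [sub_nonneg, div_le_one hp0]; exact hp.le
  have h2 := ENNReal.toReal_mono (ENNReal.mul_ne_top (ENNReal.pow_ne_top ENNReal.ofReal_ne_top)
    (ENNReal.mul_ne_top (ENNReal.mul_ne_top (ENNReal.rpow_ne_top_of_nonneg (by positivity) hX1)
      (ENNReal.rpow_ne_top_of_nonneg (by positivity) hY1))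
      (ENNReal.rpow_ne_top_of_nonneg hc₃ hS1))) h
  rw [ENNReal.toReal_mul, ENNReal.toReal_mul, ENNReal.toReal_mul, ENNReal.toReal_pow,
    ENNReal.toReal_ofReal hK.le, ← ENNReal.toReal_rpow, ← ENNReal.toReal_rpow,
    ← ENNReal.toReal_rpow] at h2
  have h3 := Real.log_le_log hC h2
  rw [Real.log_mul (by positivity) (by positivity), Real.log_mul (by positivity) (by positivity),
    Real.log_mul (by positivity) (by positivity), Real.log_pow, Real.log_rpow hA, Real.log_rpow hB,
    Real.log_rpow hC] at h3
  -- The integral `C` also occurs on the right with power `1 - 1 / p`; being finite and nonzero, it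
  -- can be absorbed on the left.
  have h4 : Real.log C.toReal ≤
      p * n * Real.log K + l * Real.log A.toReal + (1 - l) * Real.log B.toReal := by
    have := mul_le_mul_of_nonneg_left h3 hp0.le
    have e : p * (n * Real.log K + (l / p * Real.log A.toReal + (1 - l) / p * Real.log B.toReal +
        (1 - 1 / p) * Real.log C.toReal)) = p * n * Real.log K + l * Real.log A.toReal +
        (1 - l) * Real.log B.toReal + (p - 1) * Real.log C.toReal := by
      field_simp
      ring
    linarith
  have h5 := div_le_div_of_nonneg_right h4 hp1.le
  have e1 : (1 : ℝ) / (1 - p) = -(1 / (p - 1)) := by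
    rw [← neg_sub, one_div_neg_eq_neg_one_div]
  rw [e1]
  have e2 : (p * n * Real.log K + l * Real.log A.toReal + (1 - l) * Real.log B.toReal) / (p - 1) =
    p * n / (p - 1) * Real.log K + l * (1 / (p - 1) * Real.log A.toReal) +
      (1 - l) * (1 / (p - 1) * Real.log B.toReal) := by ring
  rw [e2] at h5
  have e3 : Real.log C.toReal / (p - 1) = 1 / (p - 1) * Real.log C.toReal := by ring
  rw [e3] at h5
  linarith

end

/-! ### Optimisation over `l`. -/

theorem mainTheorem1 {Ω : Type*} [MeasurableSpace Ω] (P : Measure Ω) [IsProbabilityMeasure P]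
    (n : ℕ) (hn : 1 ≤ n) (p : ℝ) (hp : 1 < p)
    (X Y : Ω → EuclideanSpace ℝ (Fin n)) (hX : Measurable X) (hY : Measurable Y)
    (hXY : IndepFun X Y P)
    (hfX : HasFiniteRenyiEntropy p P X) (hfY : HasFiniteRenyiEntropy p P Y)
    (hfXY : HasFiniteRenyiEntropy p P (X + Y)) :
    renyiEntropyPower p P X ^ renyiExponent p + renyiEntropyPower p P Y ^ renyiExponent p
        ≤ renyiEntropyPower p P (X + Y) ^ renyiExponent p ∧
      0 < renyiExponent p ∧ renyiExponent p < (p + 1) / 2 := by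
  refine ⟨?_, renyiExponent_pos_and_lt hp⟩
  have hα := (renyiExponent_pos_and_lt hp).1
  have hn0 : (0 : ℝ) < n := by exact_mod_cast hn
  unfold renyiEntropyPower
  rw [← Real.exp_mul, ← Real.exp_mul, ← Real.exp_mul]
  have hE := fun (l : ℝ) (h0 : 0 < l) (h1 : l < 1) =>
    renyiEntropy_add_ge hX hY hXY hp hfX hfY hfXY h0 h1
  have hH := fun (l : ℝ) (h0 : 0 < l) (h1 : l < 1) => binEntropy_le_renyiExponent_mul hp h0 h1
  set α := renyiExponent p
  set a := (renyiEntropy p P X).toReal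
  set b := (renyiEntropy p P Y).toReal
  set c := (renyiEntropy p P (X + Y)).toReal
  set u := Real.exp (2 * a / n * α) with hu
  set v := Real.exp (2 * b / n * α) with hv
  have hu0 : 0 < u := Real.exp_pos _
  have hv0 : 0 < v := Real.exp_pos _
  -- This `l` maximises `l log u + (1 - l) log v` plus the binary entropy of `l`, and the maximum is
  -- `log (u + v)`.
  set l := u / (u + v) with hl
  have hl0 : 0 < l := by positivity
  have hl1 : l < 1 := by rw [hl, div_lt_one (by positivity)]; linarith
  have hl' : 1 - l = v / (u + v) := by rw [hl]; field_simp; ring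
  have hE := hE l hl0 hl1
  have hH := hH l hl0 hl1
  set k := Real.log (youngConst (l * ((p - 1) / p)) ((1 - l) * ((p - 1) / p)) (1 / p))
  have e1 : Real.log l = 2 * a / n * α - Real.log (u + v) := by
    rw [hl, Real.log_div hu0.ne' (by positivity), hu, Real.log_exp]
  have e2 : Real.log (1 - l) = 2 * b / n * α - Real.log (u + v) := by
    rw [hl', Real.log_div hv0.ne' (by positivity), hv, Real.log_exp]
  rw [e1, e2] at hH
  rw [← Real.log_le_iff_le_exp (by positivity)]
  have h := mul_le_mul_of_nonneg_left hE (show 0 ≤ 2 / n * α by positivity)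
  have e3 : 2 / n * α * (l * a + (1 - l) * b - p * n / (p - 1) * k) =
      l * (2 * a / n * α) + (1 - l) * (2 * b / n * α) + α * (-(2 * p / (p - 1)) * k) := by
    have : p - 1 ≠ 0 := by linarith
    field_simp
    ring
  rw [e3] at h
  have e4 : 2 / n * α * c = 2 * c / n * α := by ring
  linarith
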